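/- **Setting.** Let $\Gamma$ be a countably infinite group and $\sigma_1,\sigma_2,\dots$ a sequence of elements generating $\Gamma$. Put $\Gamma_n=\langle\sigma_1,\dots,\sigma_n\rangle$ and assume that $\sigma_{n+1}\notin\Gamma_n$ whenever $n\ge 1$ and $\Gamma_n\ne\Gamma$. Let $G_n$ be the graph on the vertex set $\Gamma$ in which $p\neq q$ are adjacent iff $\sigma_ip=q$ or $\sigma_iq=p$ for some $1\le i\le n$; let $d_{G_n}$ be its path metric ($\infty$ between different components) and $B_t(G_n,x)$ the closed balls. In a graph, a set $T$ is *$t$-sparse* if any two distinct points of $T$ are at distance $>t$, and $T$ is an *$S$-maximal $t$-sparse set* if it is maximal among the $t$-sparse subsets of $S$. Let $\mathcal C=\{0,1\}^{\mathbb N}$. **Scales.** Fix positive integers $10=s_1<r_1<s_2<r_2<\cdots$ and $f(1)<f(2)<\cdots$, and finite sets $F_m$ with distinguished elements $q_m\in F_m$ $(m\ge1)$, such that, with $\kappa_m=|F_m|^{|B_{s_m}(G_{f(m)},e)|}$, for all $m\ge 1$: 1. there is $N<f(m+1)$ such that for every $n\ge N$: (i) some $\gamma\in\Gamma_n$ has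 $d_{G_n}(\gamma,e)\ge 1000\,r_m\kappa_m$; (ii) for every $T\subset\Gamma_n$ such that each point of $\Gamma_n$ is within $d_{G_n}$-distance $2r_m$ of $T$, there is $L\subset T$ with $|L|=\kappa_m$, with $\frac13 s_{m+1}\le d_{G_n}(e,\delta)\le\frac23 s_{m+1}$ for all $\delta\in L$, and with $d_{G_n}(\gamma,\delta)>20r_m$ for all $\gamma\ne\delta$ in $L$; 2. $10^{m}|B_{5s_m}(G_{f(m)},e)|<|\Gamma_{f(m)}|$ and $10^{m}|B_{5s_m}(G_{f(m)},e)|\le|B_{r_m/10}(G_{f(m)},e)|$, and, if $m\ge2$, $r_m\ge1000\left(\sum_{j=2}^{m}5r_{j-1}+\sum_{j=1}^{m}s_j\right)$; 3. $|B_{r_m}(G_{f(m)},e)|<|F_m|$. Let $\mathcal F=\mathcal C\times\prod_{m\ge1}F_m$ with the product topology (each $F_m$ discrete). A map $\Theta=\Theta_{\mathcal C}\times\prod_m\Theta_m:\Gamma\to\mathcal F$ is an *almost clean labeling* if $\Theta_1^{-1}(q_1)$ is a maximal $r_1$-sparse set in $G_{f(1)}$; for every $m>1$, $\Theta_m^{-1}(q_m)$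 is a $\Theta_{m-1}^{-1}(q_{m-1})$-maximal $r_m$-sparse set in $G_{f(m)}$; and for every $m\ge1$, $\Theta_m(x)\ne\Theta_m(y)$ whenever $0<d_{G_{f(m)}}(x,y)\le r_m$. Let $\zeta:\Gamma\curvearrowright\mathcal C$ be a free continuous action. A *dynamical clean labeling* is a continuous map $\Sigma:\mathcal C\to\mathcal F$ such that for every $x\in\mathcal C$ the map $\gamma\mapsto\Sigma(\zeta(\gamma)(x))$ is an almost clean labeling. Given a sequence $\{\Sigma^i\}_{i\ge1}$ of dynamical clean labelings, $y\in\mathcal C$ is *stable* if for each $x$ in the $\Gamma$-orbit of $y$ the sequence $\Sigma^n(x)$ is eventually constant; its eventual value is denoted $\Sigma^\infty(x)$. $\Gamma$ acts on $\mathcal F^\Gamma$ by $L_\delta(\rho)(\gamma)=\rho(\gamma\delta)$. **Proposition.** For every choice of the data above there is a sequence $\{\Sigma^i\}_{i\ge1}$ of dynamical clean labelings such that the set $Y$ of stable points is a $\Gamma$-invariant Borel set and * $\mu(Y)=1$ for every $\zeta$-invariant Borel probability measure $\mu$ on $\mathcal C$; * there is a nonempty closed shift-invariant set $M\subset\mathcal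 F^\Gamma$ on which the shift action is free and minimal (every orbit is dense in $M$) such that, for $y\in Y$, $\Phi(y)(\gamma)=\Sigma^\infty(\zeta(\gamma)(y))$ defines an injective equivariant Borel map $\Phi:Y\to M$. -/

import Mathlib

open Filter Topology MeasureTheory

namespace CantorLabeling

/-- The Cantor set `{0,1}^ℕ`. -/
abbrev Cantor : Type := ℕ → Bool

section Group

variable {Γ : Type*} [Group Γ]

/-- The subgroup `Γ_n` generated by the first `n` terms `σ 0, …, σ (n-1)`. -/
def genSubgroup (σ : ℕ → Γ) (n : ℕ) : Subgroup Γ :=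
  Subgroup.closure (σ '' Set.Iio n)

/-- `σ` generates the group, and as long as the first `n ≥ 1` terms do not generate it, the next
term is not in the subgroup they generate. -/
structure IsGeneratingSystem (σ : ℕ → Γ) : Prop where
  closure_range : Subgroup.closure (Set.range σ) = ⊤
  notMem : ∀ n, 1 ≤ n → genSubgroup σ n ≠ ⊤ → σ n ∉ genSubgroup σ n

/-- The graph `G_n` on `Γ`: distinct `p`, `q` are joined iff one is obtained from the other by left
multiplication with one of the first `n` generators. -/
def cayley (σ : ℕ → Γ) (n : ℕ) : SimpleGraph Γ where
  Adj p q := p ≠ q ∧ ∃ i < n, σ i * p = q ∨ σ i * q = p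
  symm := ⟨fun _ _ h => ⟨h.1.symm, h.2.imp fun _ hi => ⟨hi.1, hi.2.symm⟩⟩⟩
  loopless := ⟨fun _ h => h.1 rfl⟩

/-- The ball `B_t(G_n, x)`; points in other components are at distance `⊤`. -/
def ball (σ : ℕ → Γ) (n t : ℕ) (x : Γ) : Set Γ :=
  {y | (cayley σ n).edist x y ≤ t}

end Group

section Graph

variable {V : Type*}

/-- `T` is `t`-sparse: any two distinct points of `T` are at distance `> t`. -/
def IsSparse (G : SimpleGraph V) (t : ℕ) (T : Set V) : Prop :=
  ∀ x ∈ T, ∀ y ∈ T, x ≠ y → (t : ℕ∞) < G.edist x y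

/-- `T` is an `S`-maximal `t`-sparse set: it is maximal among the `t`-sparse subsets of `S`. -/
def IsMaximalSparseIn (G : SimpleGraph V) (S : Set V) (t : ℕ) (T : Set V) : Prop :=
  Maximal (fun T' : Set V => T' ⊆ S ∧ IsSparse G t T') T

end Graph

section Scales

variable {Γ : Type*} [Group Γ]

/-- The number `κ_m` of labelings by `F m` of the ball of radius `s m` around `1` in `G_{f m}`. -/
noncomputable def kappa (σ : ℕ → Γ) (s f : ℕ → ℕ) (F : ℕ → Type*) (m : ℕ) : ℕ :=
  Nat.card (F m) ^ (ball σ (f m) (s m) 1).ncard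

/-- The rules for the scales `s`, `r`, `f` and the finite label sets `F`. Indices start from `0`,
so `s m`, `r m`, `f m`, `F m` are the `(m+1)`-st terms of the sequences. -/
structure IsAdmissible (σ : ℕ → Γ) (s r f : ℕ → ℕ) (F : ℕ → Type*) : Prop where
  s_zero : s 0 = 10
  s_lt_r : ∀ m, s m < r m
  r_lt_s : ∀ m, r m < s (m + 1)
  f_strictMono : StrictMono f
  /-- Every sufficiently large `Γ_n` reaches distance `1000 r_m κ_m`, and every `2 r_m`-net of it
  has `κ_m` points that are `20 r_m`-sparse and lie at distance between `s_{m+1} / 3` and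
  `2 s_{m+1} / 3` from `1`. Here `N` is the bound for "sufficiently large", and `f (m + 1)`
  exceeds it. -/
  net : ∀ m, ∃ N < f (m + 1),
    (∀ n, N ≤ n → ∃ γ ∈ genSubgroup σ n,
      ((1000 * r m * kappa σ s f F m : ℕ) : ℕ∞) ≤ (cayley σ n).edist γ 1) ∧
    ∀ n, N ≤ n → ∀ T : Set Γ, T ⊆ genSubgroup σ n →
      (∀ x ∈ genSubgroup σ n, ∃ y ∈ T, (cayley σ n).edist x y ≤ (2 * r m : ℕ)) →
      ∃ L : Finset Γ, (L : Set Γ) ⊆ T ∧ L.card = kappa σ s f F m ∧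
        (∀ δ ∈ L, (s (m + 1) : ℕ∞) ≤ 3 * (cayley σ n).edist 1 δ ∧
          3 * (cayley σ n).edist 1 δ ≤ (2 * s (m + 1) : ℕ)) ∧
        IsSparse (cayley σ n) (20 * r m) (L : Set Γ)
  card_genSubgroup : ∀ m,
    10 ^ (m + 1) * (ball σ (f m) (5 * s m) 1).encard < ENat.card (genSubgroup σ (f m))
  /-- The sum is `∑_{j ≤ m} (5 r_{j-1} + s_j)`, without a term `r_{-1}`. -/
  r_large : ∀ m, 1 ≤ m →
    1000 * (∑ j ∈ Finset.range m, 5 * r j + ∑ j ∈ Finset.range (m + 1), s j) ≤ r m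
  /-- Distances are integers, so radius `r m / 10` may be rounded down. -/
  card_ball : ∀ m,
    10 ^ (m + 1) * (ball σ (f m) (5 * s m) 1).encard ≤ (ball σ (f m) (r m / 10) 1).encard
  card_labels : ∀ m, (ball σ (f m) (r m) 1).encard < ENat.card (F m)

end Scales

/-- The label space `𝓕 = 𝓒 × ∏ F_m`. -/
abbrev Label (F : ℕ → Type*) := Cantor × (∀ m, F m)

section Labelings

variable {Γ : Type*} [Group Γ] {F : ℕ → Type*}

/-- Almost clean labelings of `Γ`, with distinguished labels `q m ∈ F m`. -/
structure IsAlmostClean (σ : ℕ → Γ) (r f : ℕ → ℕ) (q : ∀ m, F m) (Θ : Γ → Label F) : Prop where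
  zero : IsMaximalSparseIn (cayley σ (f 0)) Set.univ (r 0) {x | (Θ x).2 0 = q 0}
  succ : ∀ m, IsMaximalSparseIn (cayley σ (f (m + 1))) {x | (Θ x).2 m = q m} (r (m + 1))
    {x | (Θ x).2 (m + 1) = q (m + 1)}
  proper : ∀ m x y, x ≠ y → (cayley σ (f m)).edist x y ≤ r m → (Θ x).2 m ≠ (Θ y).2 m

/-- Freeness of an action by homeomorphisms. -/
def IsFreeAction (ζ : Γ →* (Cantor ≃ₜ Cantor)) : Prop :=
  ∀ γ x, ζ γ x = x → γ = 1

/-- Dynamical clean labelings for the action `ζ`. -/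
structure IsDynamicalClean [∀ m, TopologicalSpace (F m)] (ζ : Γ →* (Cantor ≃ₜ Cantor))
    (σ : ℕ → Γ) (r f : ℕ → ℕ) (q : ∀ m, F m) (S : Cantor → Label F) : Prop where
  continuous : Continuous S
  almostClean : ∀ x, IsAlmostClean σ r f q fun γ => S (ζ γ x)

/-- The stable points of a sequence of labelings `S n : 𝓒 → 𝓕`: at each point of the orbit the
sequence of labels is eventually constant. -/
def stablePoints (ζ : Γ →* (Cantor ≃ₜ Cantor)) (S : ℕ → Cantor → Label F) : Set Cantor :=
  {y | ∀ γ, ∃ n₀, ∀ n, n₀ ≤ n → S n (ζ γ y) = S n₀ (ζ γ y)}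

end Labelings

section Shift

variable {Γ : Type*} [Group Γ] {A : Type*}

/-- The left shift action `L_δ(ρ)(γ) = ρ(γδ)` on `A^Γ`. -/
def shift (δ : Γ) (ρ : Γ → A) : Γ → A := fun γ => ρ (γ * δ)

/-- `M ⊆ A^Γ` is a free minimal subshift: a nonempty closed shift-invariant set in which every
orbit is dense and every stabilizer is trivial. -/
structure IsFreeMinimalSubshift [TopologicalSpace A] (M : Set (Γ → A)) : Prop where
  isClosed : IsClosed M
  nonempty : M.Nonempty
  shift_mem : ∀ δ, ∀ ρ ∈ M, shift δ ρ ∈ M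
  minimal : ∀ ρ ∈ M, M ⊆ closure (Set.range fun δ : Γ => shift δ ρ)
  free : ∀ δ, ∀ ρ ∈ M, shift δ ρ = ρ → δ = 1

end Shift

end CantorLabeling

open CantorLabeling

namespace CantorLabeling

section Near

variable {Γ : Type*} [Group Γ]

/-- `x` and `y` are at distance at most `t` in `G_{f m}`. -/
def near (σ : ℕ → Γ) (f : ℕ → ℕ) (m t : ℕ) (x y : Γ) : Prop :=
  (cayley σ (f m)).edist x y ≤ t

/-- The codes of patterns: labelings of the ball of radius `s m / 2` by the first `m` bits and the
labels of levels below `m`. -/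
abbrev PatternCode (N : ℕ → ℕ → Γ → Γ → Prop) (s : ℕ → ℕ) (F : ℕ → Type*) (m : ℕ) :=
  {γ // N m (s m / 2) 1 γ} → (Fin m → Bool) × (∀ i : Fin m, F i)

/-- A sequence of right invariant metrics on `Γ`, given by the relations `N m t x y` for
"`x` and `y` are at distance at most `t` in the `m`-th metric", with the growth properties of the
scales `s` and `r` that are used to glue labelings. -/
structure IsScaleSystem (N : ℕ → ℕ → Γ → Γ → Prop) (s r : ℕ → ℕ) (F : ℕ → Type*) : Prop where
  refl : ∀ m t x, N m t x x
  symm : ∀ {m t x y}, N m t x y → N m t y x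
  trans : ∀ {m t u x y z}, N m t x y → N m u y z → N m (t + u) x z
  mono : ∀ {m n t u x y}, m ≤ n → t ≤ u → N m t x y → N n u x y
  mul_right : ∀ {m t x y} (g : Γ), N m t (x * g) (y * g) ↔ N m t x y
  finite : ∀ m t x, {y | N m t x y}.Finite
  exists_far : ∀ m, ∃ u, N m (3 * s m) 1 u ∧ ¬ N m (2 * s m) 1 u
  ten_le : ∀ m, 10 ≤ s m
  s_lt_r : ∀ m, 50 * s m < r m
  r_lt_s : ∀ m, 15 * r m < s (m + 1)
  card_labels : ∀ m x, {y | N m (r m) x y}.ncard < Nat.card (F m)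
  card_ball : ∀ m, 10 ^ (m + 1) * {y | N m (5 * s m) 1 y}.ncard ≤ {y | N m (r m / 10) 1 y}.ncard
  net : ∀ m (T : Set Γ), (∀ x, ∃ y ∈ T, N m (2 * r m) x y) →
    ∃ L : Finset Γ, (L : Set Γ) ⊆ T ∧ Nat.card (PatternCode N s F m) ≤ L.card ∧
      (∀ δ ∈ L, N (m + 1) (2 * s (m + 1) / 3) 1 δ) ∧
      ∀ δ ∈ L, ∀ δ' ∈ L, N (m + 1) (20 * r m) δ δ' → δ = δ'
  exhaust : ∀ γ : Γ, ∃ m₀, ∀ m ≥ m₀, N m (s m / 2) 1 γ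

variable {σ : ℕ → Γ} {s r f : ℕ → ℕ}

theorem near_iff_exists_walk {m t : ℕ} {x y : Γ} :
    near σ f m t x y ↔ ∃ p : (cayley σ (f m)).Walk x y, p.length ≤ t := by
  constructor
  · intro h
    have hne : (cayley σ (f m)).edist x y ≠ ⊤ := fun h' => by
      rw [near, h'] at h
      exact absurd h (by simp)
    obtain ⟨p, hp⟩ := SimpleGraph.exists_walk_of_edist_ne_top hne
    refine ⟨p, ?_⟩
    rw [near, ← hp] at h
    exact_mod_cast h
  · rintro ⟨p, hp⟩
    exact (SimpleGraph.edist_le p).trans (by exact_mod_cast hp)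

theorem near_refl (m t : ℕ) (x : Γ) : near σ f m t x x := by
  simp [near]

theorem near_symm {m t : ℕ} {x y : Γ} (h : near σ f m t x y) : near σ f m t y x := by
  rwa [near, SimpleGraph.edist_comm]

theorem near_trans {m t u : ℕ} {x y z : Γ} (h : near σ f m t x y) (h' : near σ f m u y z) :
    near σ f m (t + u) x z := by
  refine SimpleGraph.edist_triangle.trans ((add_le_add h h').trans (by simp))

theorem cayley_mono {a b : ℕ} (h : a ≤ b) : cayley σ a ≤ cayley σ b := by
  intro x y hxy
  exact ⟨hxy.1, hxy.2.imp fun i hi => ⟨hi.1.trans_le h, hi.2⟩⟩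

theorem near_mono (hf : Monotone f) {m n t u : ℕ} {x y : Γ} (hmn : m ≤ n) (htu : t ≤ u)
    (h : near σ f m t x y) : near σ f n u x y :=
  (SimpleGraph.edist_anti (cayley_mono (hf hmn))).trans (h.trans (by exact_mod_cast htu))

theorem near_mul_right_of_near {m t : ℕ} {x y : Γ} (g : Γ) (h : near σ f m t x y) :
    near σ f m t (x * g) (y * g) := by
  obtain ⟨p, hp⟩ := near_iff_exists_walk.1 h
  let φ : cayley σ (f m) →g cayley σ (f m) :=
    { toFun := fun x => x * g
      map_rel' := by
        rintro a b ⟨hab, i, hi, h⟩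
        refine ⟨by simpa using hab, i, hi, ?_⟩
        rcases h with h | h
        · left; rw [← h, mul_assoc]
        · right; rw [← h, mul_assoc] }
  exact near_iff_exists_walk.2 ⟨p.map φ, by simpa using hp⟩

theorem near_mul_right {m t : ℕ} {x y : Γ} (g : Γ) :
    near σ f m t (x * g) (y * g) ↔ near σ f m t x y :=
  ⟨fun h => by simpa using near_mul_right_of_near g⁻¹ h, near_mul_right_of_near g⟩

/-- Balls in the Cayley graph interpolate: a point at distance `t + u` is reached in two steps. -/
theorem near_split {m t u : ℕ} {x y : Γ} (h : near σ f m (t + u) x y) :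
    ∃ z, near σ f m t x z ∧ near σ f m u z y := by
  obtain ⟨p, hp⟩ := near_iff_exists_walk.1 h
  refine ⟨p.getVert t, near_iff_exists_walk.2 ⟨p.take t, ?_⟩,
    near_iff_exists_walk.2 ⟨p.drop t, ?_⟩⟩
  · simp
  · simp; omega

theorem near_generator {m i : ℕ} (hi : i < f m) (x : Γ) : near σ f m 1 x (σ i * x) := by
  rw [near]
  by_cases h : x = σ i * x
  · rw [← h]; simp
  · have : (cayley σ (f m)).Adj x (σ i * x) := ⟨h, i, hi, Or.inl rfl⟩
    exact (SimpleGraph.edist_eq_one_iff_adj.2 this).le.trans (by simp)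

theorem exists_near_of_mem {m : ℕ} {γ : Γ} (h : γ ∈ genSubgroup σ (f m)) :
    ∃ t, near σ f m t 1 γ := by
  induction h using Subgroup.closure_induction with
  | mem x hx =>
    obtain ⟨i, hi, rfl⟩ := hx
    exact ⟨1, by simpa using near_generator (σ := σ) hi 1⟩
  | one => exact ⟨0, near_refl _ _ _⟩
  | mul x y _ _ hx hy =>
    obtain ⟨t, ht⟩ := hx
    obtain ⟨u, hu⟩ := hy
    refine ⟨u + t, near_trans hu ?_⟩
    simpa using (near_mul_right y).2 ht
  | inv x _ hx =>
    obtain ⟨t, ht⟩ := hx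
    exact ⟨t, near_symm (by simpa using (near_mul_right x⁻¹).2 ht)⟩

theorem mul_inv_mem_of_near {m t : ℕ} {x y : Γ} (h : near σ f m t x y) :
    y * x⁻¹ ∈ genSubgroup σ (f m) := by
  obtain ⟨p, -⟩ := near_iff_exists_walk.1 h
  clear h
  induction p with
  | nil => simp
  | @cons a b c hab p ih =>
    have hb : b * a⁻¹ ∈ genSubgroup σ (f m) := by
      obtain ⟨-, i, hi, h⟩ := hab
      have hσ : σ i ∈ genSubgroup σ (f m) := Subgroup.subset_closure ⟨i, hi, rfl⟩
      rcases h with h | h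
      · rw [← h]; simpa using hσ
      · rw [← h]; simpa using inv_mem hσ
    simpa [mul_assoc] using mul_mem ih hb

theorem genSubgroup_mono {a b : ℕ} (h : a ≤ b) : genSubgroup σ a ≤ genSubgroup σ b :=
  Subgroup.closure_mono (Set.image_mono (Set.Iio_subset_Iio h))

theorem near_translate_ball {m t : ℕ} (x : Γ) :
    {y | near σ f m t x y} = (fun y => y * x) '' {y | near σ f m t 1 y} := by
  ext y
  simp only [Set.mem_ofPred_eq, Set.mem_image]
  constructor
  · intro h
    exact ⟨y * x⁻¹, by simpa using (near_mul_right x⁻¹).2 h, by simp⟩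
  · rintro ⟨z, hz, rfl⟩
    simpa using (near_mul_right x).2 hz

end Near

section Admissible

variable {Γ : Type*} [Group Γ] {σ : ℕ → Γ} {s r f : ℕ → ℕ} {F : ℕ → Type*}

theorem ENat.le_div_three {e : ℕ∞} {n : ℕ} (h : 3 * e ≤ (n : ℕ∞)) : e ≤ (n / 3 : ℕ) := by
  cases e with
  | top => exact absurd h (by simp)
  | coe k =>
    have h' : 3 * k ≤ n := by exact_mod_cast h
    have : k ≤ n / 3 := by omega
    exact_mod_cast this

theorem near_finite_of_admissible (h : IsAdmissible σ s r f F) [∀ m, Finite (F m)] (m t : ℕ)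
    (x : Γ) : {y | near σ f m t x y}.Finite := by
  have hr : {y | near σ f m (r m) 1 y}.Finite := by
    have := h.card_labels m
    exact Set.encard_lt_top_iff.1 (this.trans_le le_top)
  have h1 : ∀ x : Γ, {y | near σ f m 1 x y}.Finite := by
    intro x
    rw [near_translate_ball]
    refine (hr.subset fun y hy => ?_).image _
    exact near_mono (f := f) h.f_strictMono.monotone le_rfl
      (by have := h.s_lt_r m; omega) (show near σ f m 1 1 y from hy)
  induction t with
  | zero =>
    refine (Set.finite_singleton x).subset fun y hy => ?_
    have h0 : (cayley σ (f m)).edist x y ≤ (0 : ℕ) := hy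
    rw [Nat.cast_zero, nonpos_iff_eq_zero, SimpleGraph.edist_eq_zero_iff] at h0
    exact h0.symm
  | succ t ih =>
    refine (ih.biUnion fun z _ => h1 z).subset fun y hy => ?_
    obtain ⟨z, hz, hzy⟩ := near_split hy
    exact Set.mem_biUnion hz hzy

theorem ten_le_of_admissible (h : IsAdmissible σ s r f F) (m : ℕ) : 10 ≤ s m := by
  induction m with
  | zero => exact h.s_zero.ge
  | succ m ih =>
    have := h.s_lt_r m
    have := h.r_lt_s m
    omega

theorem encard_ball_of_admissible (h : IsAdmissible σ s r f F) [∀ m, Finite (F m)] (m t : ℕ) :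
    (ball σ (f m) t 1).encard = ({y | near σ f m t 1 y}.ncard : ℕ) :=
  ((near_finite_of_admissible h m t 1).cast_ncard_eq).symm

theorem ncard_ball_pos (h : IsAdmissible σ s r f F) [∀ m, Finite (F m)] (m t : ℕ) :
    0 < {y | near σ f m t 1 y}.ncard :=
  (Set.ncard_pos (near_finite_of_admissible h m t 1)).2 ⟨1, near_refl _ _ _⟩

theorem card_ball_of_admissible (h : IsAdmissible σ s r f F) [∀ m, Finite (F m)] (m : ℕ) :
    10 ^ (m + 1) * {y | near σ f m (5 * s m) 1 y}.ncard ≤ {y | near σ f m (r m / 10) 1 y}.ncard := by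
  have := h.card_ball m
  rw [encard_ball_of_admissible h, encard_ball_of_admissible h] at this
  exact_mod_cast this

theorem fifty_mul_lt_of_admissible (h : IsAdmissible σ s r f F) [∀ m, Finite (F m)] (m : ℕ) :
    50 * s m < r m := by
  by_contra! hle
  have h1 := card_ball_of_admissible h m
  have h2 : {y | near σ f m (r m / 10) 1 y}.ncard ≤ {y | near σ f m (5 * s m) 1 y}.ncard :=
    Set.ncard_le_ncard (fun y hy => near_mono h.f_strictMono.monotone le_rfl
      (show r m / 10 ≤ 5 * s m by omega) hy) (near_finite_of_admissible h m _ 1)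
  have h3 := ncard_ball_pos h m (5 * s m)
  have h4 : 10 ≤ 10 ^ (m + 1) := by
    calc 10 = 10 ^ 1 := by norm_num
      _ ≤ 10 ^ (m + 1) := Nat.pow_le_pow_right (by norm_num) (by omega)
  have h5 := Nat.mul_le_mul_right ({y | near σ f m (5 * s m) 1 y}.ncard) h4
  omega

theorem card_labels_of_admissible (h : IsAdmissible σ s r f F) [∀ m, Finite (F m)] (m : ℕ)
    (x : Γ) : {y | near σ f m (r m) x y}.ncard < Nat.card (F m) := by
  rw [near_translate_ball, Set.ncard_image_of_injective _ (mul_left_injective x)]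
  have := h.card_labels m
  rw [encard_ball_of_admissible h, ENat.card_eq_coe_natCard] at this
  exact_mod_cast this

theorem exists_far_of_admissible (h : IsAdmissible σ s r f F) [∀ m, Finite (F m)] (m : ℕ) :
    ∃ u, near σ f m (3 * s m) 1 u ∧ ¬ near σ f m (3 * s m - 1) 1 u := by
  have hex : ∃ γ ∈ genSubgroup σ (f m), ¬ near σ f m (5 * s m) 1 γ := by
    by_contra! hall
    have h1 : (genSubgroup σ (f m) : Set Γ) ⊆ ball σ (f m) (5 * s m) 1 := fun γ hγ => hall γ hγ
    have h2 := Set.encard_le_encard h1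
    have h3 := h.card_genSubgroup m
    have h4 : ENat.card (genSubgroup σ (f m)) = (genSubgroup σ (f m) : Set Γ).encard := rfl
    rw [h4] at h3
    have h5 : (ball σ (f m) (5 * s m) 1).encard ≤
        10 ^ (m + 1) * (ball σ (f m) (5 * s m) 1).encard := by
      rw [encard_ball_of_admissible h]
      norm_cast
      exact Nat.le_mul_of_pos_left _ (by positivity)
    exact absurd (h3.trans_le h2) (not_lt.2 h5)
  obtain ⟨γ, hγ, hfar⟩ := hex
  have hlen := exists_near_of_mem hγ
  classical
  have hmin := Nat.find_spec hlen
  set t := Nat.find hlen with ht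
  have hmono := h.f_strictMono.monotone
  have h5 : 5 * s m < t := by
    by_contra! hle
    exact hfar (near_mono hmono le_rfl hle hmin)
  have hs := ten_le_of_admissible h m
  rw [show t = 3 * s m + (t - 3 * s m) by omega] at hmin
  obtain ⟨u, hu, hu'⟩ := near_split hmin
  refine ⟨u, hu, fun hu2 => ?_⟩
  exact Nat.find_min hlen (show 3 * s m - 1 + (t - 3 * s m) < Nat.find hlen by omega)
    (near_trans hu2 hu')

theorem two_le_card_of_admissible (h : IsAdmissible σ s r f F) [∀ m, Finite (F m)] (m : ℕ) :
    2 ≤ Nat.card (F m) := by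
  have := card_labels_of_admissible h m 1
  have := ncard_ball_pos h m (r m)
  omega

theorem three_le_ncard_ball (h : IsAdmissible σ s r f F) [∀ m, Finite (F m)] (m : ℕ) :
    3 ≤ {y | near σ f m (s m) 1 y}.ncard := by
  obtain ⟨u, hu, hu2⟩ := exists_far_of_admissible h m
  have hs := ten_le_of_admissible h m
  have hmono := h.f_strictMono.monotone
  obtain ⟨v, hv, hvu⟩ := near_split (t := s m) (u := 2 * s m) (by convert hu using 1; ring)
  obtain ⟨w, hw, hwv⟩ := near_split (t := 1) (u := s m - 1) (by convert hv using 1; omega)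
  have h1v : (1 : Γ) ≠ v := by
    rintro rfl
    exact hu2 (near_mono hmono le_rfl (by omega) hvu)
  have h1w : (1 : Γ) ≠ w := by
    rintro rfl
    exact hu2 (near_mono hmono le_rfl (by omega) (near_trans hwv hvu))
  have hwv' : w ≠ v := by
    rintro rfl
    exact hu2 (near_mono hmono le_rfl (by omega) (near_trans hw hvu))
  have hsub : ({1, w, v} : Set Γ) ⊆ {y | near σ f m (s m) 1 y} := by
    rintro x (rfl | rfl | rfl)
    · exact near_refl _ _ _
    · exact near_mono hmono le_rfl (by omega) hw
    · exact hv
  have := Set.ncard_le_ncard hsub (near_finite_of_admissible h m _ 1)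
  rwa [Set.ncard_eq_three.2 ⟨1, w, v, h1w, h1v, hwv', rfl⟩] at this

theorem kappa_eq (m : ℕ) :
    kappa σ s f F m = Nat.card (F m) ^ {y | near σ f m (s m) 1 y}.ncard := rfl

/-- The form in which the net condition is used: the net lies in all of `Γ`, and is a net for the
coarser metric. -/
theorem exists_separated_of_admissible (h : IsAdmissible σ s r f F) (m : ℕ) (T : Set Γ)
    (hT : ∀ x, ∃ y ∈ T, near σ f m (2 * r m) x y) :
    ∃ L : Finset Γ, (L : Set Γ) ⊆ T ∧ L.card = kappa σ s f F m ∧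
      (∀ δ ∈ L, near σ f (m + 1) (2 * s (m + 1) / 3) 1 δ) ∧
      ∀ δ ∈ L, ∀ δ' ∈ L, near σ f (m + 1) (20 * r m) δ δ' → δ = δ' := by
  have hmono := h.f_strictMono.monotone
  obtain ⟨N, hN, -, hnet⟩ := h.net m
  obtain ⟨L, hLT, hcard, hdist, hsp⟩ := hnet (f (m + 1)) hN.le
    (T ∩ genSubgroup σ (f (m + 1))) Set.inter_subset_right fun x hx => by
      obtain ⟨y, hy, hxy⟩ := hT x
      refine ⟨y, ⟨hy, ?_⟩, near_mono hmono (Nat.le_succ m) le_rfl hxy⟩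
      have := genSubgroup_mono (hmono (Nat.le_succ m)) (mul_inv_mem_of_near hxy)
      simpa using mul_mem this hx
  refine ⟨L, hLT.trans Set.inter_subset_left, hcard,
    fun δ hδ => ENat.le_div_three (hdist δ hδ).2, fun δ hδ δ' hδ' hn => ?_⟩
  by_contra hne
  exact absurd hn (not_le.2 (hsp δ hδ δ' hδ' hne))

theorem two_le_kappa (h : IsAdmissible σ s r f F) [∀ m, Finite (F m)] (m : ℕ) :
    2 ≤ kappa σ s f F m := by
  rw [kappa_eq]
  exact (two_le_card_of_admissible h m).trans
    (Nat.le_self_pow (ncard_ball_pos h m _).ne' _)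

theorem fifteen_mul_lt_of_admissible (h : IsAdmissible σ s r f F) [∀ m, Finite (F m)] (m : ℕ) :
    15 * r m < s (m + 1) := by
  obtain ⟨L, -, hcard, hdist, hsp⟩ := exists_separated_of_admissible h m Set.univ
    fun x => ⟨x, trivial, near_refl _ _ _⟩
  have h2 := two_le_kappa h m
  obtain ⟨a, ha, b, hb, hab⟩ := Finset.one_lt_card.1 (show 1 < L.card by omega)
  by_contra! hle
  refine hab (hsp a ha b hb ?_)
  exact near_mono h.f_strictMono.monotone le_rfl (by omega)
    (near_trans (near_symm (hdist a ha)) (hdist b hb))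

theorem kappa_lt_card (h : IsAdmissible σ s r f F) [∀ m, Finite (F m)] (m : ℕ) :
    kappa σ s f F m < Nat.card (F (m + 1)) := by
  obtain ⟨L, -, hcard, hdist, hsp⟩ := exists_separated_of_admissible h m Set.univ
    fun x => ⟨x, trivial, near_refl _ _ _⟩
  rw [← hcard, ← Set.ncard_coe_finset]
  refine (Set.ncard_le_ncard (fun δ hδ => ?_) (near_finite_of_admissible h (m + 1) (r (m + 1)) 1)).trans_lt
    (card_labels_of_admissible h (m + 1) 1)
  have := h.s_lt_r (m + 1)
  exact near_mono h.f_strictMono.monotone le_rfl (by omega) (hdist δ hδ)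

theorem prod_card_le (h : IsAdmissible σ s r f F) [∀ m, Finite (F m)] (m : ℕ) :
    2 ^ m * ∏ i : Fin m, Nat.card (F i) ≤ Nat.card (F m) := by
  induction m with
  | zero =>
    have := two_le_card_of_admissible h 0
    simp; omega
  | succ m ih =>
    refine le_trans ?_ (kappa_lt_card h m).le
    have h2 := two_le_card_of_admissible h m
    rw [kappa_eq, Fin.prod_univ_castSucc]
    simp only [Fin.val_castSucc, Fin.val_last]
    calc 2 ^ (m + 1) * ((∏ i : Fin m, Nat.card (F i)) * Nat.card (F m))
        = (2 ^ m * ∏ i : Fin m, Nat.card (F i)) * Nat.card (F m) * 2 := by ring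
      _ ≤ Nat.card (F m) * Nat.card (F m) * Nat.card (F m) := by gcongr
      _ = Nat.card (F m) ^ 3 := by ring
      _ ≤ _ := Nat.pow_le_pow_right (by omega) (three_le_ncard_ball h m)

theorem card_patternCode_le (h : IsAdmissible σ s r f F) [∀ m, Finite (F m)] (m : ℕ) :
    Nat.card (PatternCode (near σ f) s F m) ≤ kappa σ s f F m := by
  have hfin := near_finite_of_admissible h m (s m / 2) 1
  have : Finite {γ // near σ f m (s m / 2) 1 γ} := hfin
  rw [Nat.card_fun, Nat.card_prod, Nat.card_fun, Nat.card_pi, Nat.card_fin, kappa_eq]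
  simp only [Nat.card_eq_fintype_card, Fintype.card_bool]
  have h2 := two_le_card_of_admissible h m
  refine (Nat.pow_le_pow_left (by simpa using prod_card_le h m) _).trans
    (Nat.pow_le_pow_right (by omega) ?_)
  exact Set.ncard_le_ncard (fun γ hγ => near_mono h.f_strictMono.monotone le_rfl
    (by omega) hγ) (near_finite_of_admissible h m _ 1)

theorem le_s_of_admissible (h : IsAdmissible σ s r f F) (m : ℕ) : m ≤ s m := by
  induction m with
  | zero => omega
  | succ m ih =>
    have := h.s_lt_r m
    have := h.r_lt_s m
    omega

theorem exhaust_of_admissible (h : IsAdmissible σ s r f F) (hσ : IsGeneratingSystem σ) (γ : Γ) :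
    ∃ m₀, ∀ m ≥ m₀, near σ f m (s m / 2) 1 γ := by
  have hmono := h.f_strictMono.monotone
  have key : ∃ m t, near σ f m t 1 γ := by
    have hγ : γ ∈ Subgroup.closure (Set.range σ) := hσ.closure_range ▸ Subgroup.mem_top γ
    have hrange : Set.range σ = ⋃ n, σ '' Set.Iio (f n) := by
      ext x
      simp only [Set.mem_range, Set.mem_iUnion, Set.mem_image, Set.mem_Iio]
      constructor
      · rintro ⟨i, rfl⟩
        exact ⟨i + 1, i, (Nat.lt_succ_self i).trans_le (h.f_strictMono.id_le _), rfl⟩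
      · rintro ⟨n, i, -, rfl⟩
        exact ⟨i, rfl⟩
    rw [hrange, Subgroup.closure_iUnion] at hγ
    have hdir : Directed (· ≤ ·) fun n => genSubgroup σ (f n) :=
      (monotone_nat_of_le_succ fun n => genSubgroup_mono (hmono (Nat.le_succ n))).directed_le
    obtain ⟨m, hm⟩ := (Subgroup.mem_iSup_of_directed hdir).1 hγ
    exact ⟨m, exists_near_of_mem hm⟩
  obtain ⟨m, t, ht⟩ := key
  refine ⟨max m (2 * t), fun n hn => near_mono hmono ((le_max_left _ _).trans hn) ?_ ht⟩
  have h1 := le_s_of_admissible h n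
  have h2 := (le_max_right m (2 * t)).trans hn
  omega

theorem isScaleSystem_near (h : IsAdmissible σ s r f F) (hσ : IsGeneratingSystem σ)
    [∀ m, Finite (F m)] : IsScaleSystem (near σ f) s r F where
  refl := near_refl
  symm := near_symm
  trans := near_trans
  mono := near_mono h.f_strictMono.monotone
  mul_right := near_mul_right
  finite := near_finite_of_admissible h
  exists_far m := by
    obtain ⟨u, hu, hu'⟩ := exists_far_of_admissible h m
    have := ten_le_of_admissible h m
    exact ⟨u, hu, fun h2 => hu' (near_mono h.f_strictMono.monotone le_rfl (by omega) h2)⟩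
  ten_le := ten_le_of_admissible h
  s_lt_r := fifty_mul_lt_of_admissible h
  r_lt_s := fifteen_mul_lt_of_admissible h
  card_labels := card_labels_of_admissible h
  card_ball := card_ball_of_admissible h
  net m T hT := by
    obtain ⟨L, h1, h2, h3, h4⟩ := exists_separated_of_admissible h m T hT
    exact ⟨L, h1, (card_patternCode_le h m).trans h2.ge, h3, h4⟩
  exhaust := exhaust_of_admissible h hσ

end Admissible

section Labelings

variable {F : ℕ → Type*}

/-- Two labels agree in the first `m` bits and in the levels below `m`. -/
def Agree (m : ℕ) (l l' : Label F) : Prop :=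
  ∀ i < m, l.1 i = l'.1 i ∧ l.2 i = l'.2 i

theorem Agree.refl (m : ℕ) (l : Label F) : Agree m l l := fun _ _ => ⟨rfl, rfl⟩

theorem Agree.symm {m : ℕ} {l l' : Label F} (h : Agree m l l') : Agree m l' l :=
  fun i hi => ⟨(h i hi).1.symm, (h i hi).2.symm⟩

theorem Agree.trans {m : ℕ} {l l' l'' : Label F} (h : Agree m l l') (h' : Agree m l' l'') :
    Agree m l l'' :=
  fun i hi => ⟨(h i hi).1.trans (h' i hi).1, (h i hi).2.trans (h' i hi).2⟩

theorem Agree.mono {m n : ℕ} {l l' : Label F} (hmn : m ≤ n) (h : Agree n l l') : Agree m l l' :=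
  fun i hi => h i (hi.trans_le hmn)

theorem agree_zero (l l' : Label F) : Agree 0 l l' := fun _ hi => absurd hi (Nat.not_lt_zero _)

theorem Agree.of_eq {m : ℕ} {l l' : Label F} (h : l = l') : Agree m l l' := h ▸ Agree.refl m l

/-- The label with the first `m` bits and the levels below `m` of `l`, and the rest of `l'`. -/
def splice (m : ℕ) (l l' : Label F) : Label F :=
  (fun i => if i < m then l.1 i else l'.1 i, fun i => if i < m then l.2 i else l'.2 i)

theorem agree_splice (m : ℕ) (l l' : Label F) : Agree m (splice m l l') l :=
  fun i hi => by simp [splice, hi]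

theorem splice_level {m i : ℕ} (h : m ≤ i) (l l' : Label F) : (splice m l l').2 i = l'.2 i := by
  simp [splice, h]

theorem splice_bit {m i : ℕ} (h : m ≤ i) (l l' : Label F) : (splice m l l').1 i = l'.1 i := by
  simp [splice, h]

theorem splice_eq_of_agree {m : ℕ} {l l' : Label F} (h : Agree m l l') : splice m l l' = l' := by
  refine Prod.ext (funext fun i => ?_) (funext fun i => ?_) <;> by_cases hi : i < m
  · simp [splice, hi, (h i hi).1]
  · simp [splice, hi]
  · simp [splice, hi, (h i hi).2]
  · simp [splice, hi]

variable {Γ : Type*}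

/-- The points with the distinguished label at level `m`. -/
def marked (q : ∀ m, F m) (m : ℕ) (Θ : Γ → Label F) : Set Γ := {x | (Θ x).2 m = q m}

/-- The set in which the points marked at level `m` are maximal. -/
def premarked (q : ∀ m, F m) : ℕ → (Γ → Label F) → Set Γ
  | 0, _ => Set.univ
  | m + 1, Θ => marked q m Θ

/-- The conditions on the labels of level `m` in an almost clean labeling. -/
structure CleanAt (N : ℕ → ℕ → Γ → Γ → Prop) (r : ℕ → ℕ) (q : ∀ m, F m) (m : ℕ)
    (Θ : Γ → Label F) : Prop where
  proper : ∀ x y, x ≠ y → N m (r m) x y → (Θ x).2 m ≠ (Θ y).2 m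
  subset : marked q m Θ ⊆ premarked q m Θ
  maximal : ∀ x ∈ premarked q m Θ, ∃ y ∈ marked q m Θ, N m (r m) x y

variable {N : ℕ → ℕ → Γ → Γ → Prop} {s r : ℕ → ℕ} {q : ∀ m, F m} {Θ Θ' : Γ → Label F}

theorem Agree.marked_iff {k m : ℕ} (hk : k < m) {x y : Γ} (h : Agree m (Θ x) (Θ' y)) :
    x ∈ marked q k Θ ↔ y ∈ marked q k Θ' := by
  show (Θ x).2 k = q k ↔ (Θ' y).2 k = q k
  rw [(h k hk).2]

theorem Agree.premarked_iff {k m : ℕ} (hk : k < m) {x y : Γ} (h : Agree m (Θ x) (Θ' y)) :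
    x ∈ premarked q k Θ ↔ y ∈ premarked q k Θ' := by
  cases k with
  | zero => exact Iff.rfl
  | succ k => exact h.marked_iff (by omega)

theorem CleanAt.eq_of_near {k : ℕ} (h : CleanAt N r q k Θ) {x y : Γ} (hx : x ∈ marked q k Θ)
    (hy : y ∈ marked q k Θ) (hxy : N k (r k) x y) : x = y := by
  by_contra hne
  exact h.proper x y hne hxy (Eq.trans hx (Eq.symm hy))

theorem cleanAt_congr {k : ℕ} (h : ∀ x, (Θ x).2 k = (Θ' x).2 k)
    (h' : premarked q k Θ = premarked q k Θ') (hg : CleanAt N r q k Θ') :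
    CleanAt N r q k Θ := by
  have hm : marked q k Θ = marked q k Θ' := Set.ext fun x => by simp [marked, h]
  refine ⟨fun x y hne hxy => ?_, ?_, ?_⟩
  · rw [h, h]
    exact hg.proper x y hne hxy
  · rw [hm, h']
    exact hg.subset
  · rw [hm, h']
    exact hg.maximal

variable [Group Γ]

/-- The level-`m` pattern of `Θ'` around `1` occurs in `Θ` in the `s (m + 1)`-ball around `c`. -/
def Visits (N : ℕ → ℕ → Γ → Γ → Prop) (s : ℕ → ℕ) (m : ℕ) (Θ : Γ → Label F) (c : Γ)
    (Θ' : Γ → Label F) : Prop :=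
  ∃ ε, N (m + 1) (s (m + 1) - s m) c ε ∧ ∀ γ, N m (s m / 2) 1 γ → Agree m (Θ (γ * ε)) (Θ' γ)

/-- Labelings which are clean in the levels below `k`, and in which every pattern of level `m` of a
good labeling occurs around every point marked at a level `m + 1` below `k`. -/
def Good (N : ℕ → ℕ → Γ → Γ → Prop) (s r : ℕ → ℕ) (q : ∀ m, F m) : ℕ → (Γ → Label F) → Prop
  | 0, _ => True
  | 1, Θ => CleanAt N r q 0 Θ
  | m + 2, Θ => Good N s r q (m + 1) Θ ∧ CleanAt N r q (m + 1) Θ ∧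
      ∀ c ∈ marked q (m + 1) Θ, ∀ Θ', Good N s r q m Θ' → Visits N s m Θ c Θ'

/-- Every pattern of level `m` of a good labeling occurs around `c`. -/
def VisitsAll (N : ℕ → ℕ → Γ → Γ → Prop) (s r : ℕ → ℕ) (q : ∀ m, F m) (m : ℕ) (Θ : Γ → Label F)
    (c : Γ) : Prop :=
  ∀ Θ', Good N s r q m Θ' → Visits N s m Θ c Θ'

theorem Good.pred {k : ℕ} (h : Good N s r q (k + 1) Θ) : Good N s r q k Θ := by
  cases k with
  | zero => trivial
  | succ k => exact h.1

theorem Good.cleanAt {k : ℕ} (h : Good N s r q (k + 1) Θ) : CleanAt N r q k Θ := by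
  cases k with
  | zero => exact h
  | succ k => exact h.2.1

theorem Good.mono {j k : ℕ} (hjk : j ≤ k) (h : Good N s r q k Θ) : Good N s r q j Θ := by
  induction hjk with
  | refl => exact h
  | step _ ih => exact ih h.pred

theorem Good.visitsAll {k : ℕ} (h : Good N s r q (k + 2) Θ) {c : Γ}
    (hc : c ∈ marked q (k + 1) Θ) : VisitsAll N s r q k Θ c := h.2.2 c hc

section Scale

variable (H : IsScaleSystem N s r F)
include H

theorem IsScaleSystem.r_lt_r (m : ℕ) : 750 * r m < r (m + 1) := by
  have := H.s_lt_r (m + 1)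
  have := H.r_lt_s m
  omega

theorem IsScaleSystem.r_mono : Monotone r :=
  monotone_nat_of_le_succ fun m => by have := H.r_lt_r m; omega

theorem IsScaleSystem.near_mul {m t : ℕ} {γ x : Γ} : N m t 1 γ ↔ N m t x (γ * x) := by
  conv_rhs => rw [← one_mul x, ← mul_assoc, mul_one]
  exact (H.mul_right x).symm

theorem IsScaleSystem.near_mul_inv {m t : ℕ} {x y : Γ} : N m t 1 (y * x⁻¹) ↔ N m t x y := by
  rw [H.near_mul (x := x)]; simp

theorem cleanAt_of_local {k : ℕ} (h : ∀ p, ∃ Θ', CleanAt N r q k Θ' ∧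
    ∀ x, N k (r k) p x → Agree (k + 1) (Θ x) (Θ' x)) : CleanAt N r q k Θ := by
  refine ⟨fun x y hne hxy => ?_, fun x hx => ?_, fun x hx => ?_⟩ <;>
    obtain ⟨Θ', hc, ha⟩ := h x <;> have hax := ha x (H.refl _ _ _)
  · rw [(hax k k.lt_succ_self).2, (ha y hxy k k.lt_succ_self).2]
    exact hc.proper x y hne hxy
  · exact (hax.premarked_iff k.lt_succ_self).2 (hc.subset ((hax.marked_iff k.lt_succ_self).1 hx))
  · obtain ⟨y, hy, hxy⟩ := hc.maximal x ((hax.premarked_iff k.lt_succ_self).1 hx)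
    exact ⟨y, ((ha y hxy).marked_iff k.lt_succ_self).2 hy, hxy⟩

theorem visits_congr {m : ℕ} {c : Γ} {Θ₁ : Γ → Label F}
    (h : ∀ x, N (m + 1) (s (m + 1)) c x → Agree m (Θ' x) (Θ x)) (hv : Visits N s m Θ c Θ₁) :
    Visits N s m Θ' c Θ₁ := by
  obtain ⟨ε, hε, hγ⟩ := hv
  refine ⟨ε, hε, fun γ hγ1 => (h _ ?_).trans (hγ γ hγ1)⟩
  have h1 := (H.near_mul (x := ε)).1 hγ1
  have := H.r_lt_s m
  have := H.s_lt_r m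
  exact H.mono le_rfl (show s (m + 1) - s m + s m / 2 ≤ s (m + 1) by omega)
    (H.trans hε (H.mono (Nat.le_succ m) le_rfl h1))

/-- Goodness is a local condition. -/
theorem good_of_local {k : ℕ} (h : ∀ p, ∃ Θ', Good N s r q (k + 1) Θ' ∧
    ∀ x, N k (r k) p x → Agree (k + 1) (Θ x) (Θ' x)) : Good N s r q (k + 1) Θ := by
  induction k with
  | zero => exact cleanAt_of_local H h
  | succ k ih =>
    refine ⟨ih fun p => ?_, cleanAt_of_local H fun p => ?_, fun c hc Θ₁ hΘ₁ => ?_⟩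
    · obtain ⟨Θ', hg, ha⟩ := h p
      exact ⟨Θ', hg.pred, fun x hx => (ha x (H.mono (Nat.le_succ k) (H.r_mono (Nat.le_succ k))
        hx)).mono (Nat.le_succ _)⟩
    · obtain ⟨Θ', hg, ha⟩ := h p
      exact ⟨Θ', hg.cleanAt, ha⟩
    · obtain ⟨Θ', hg, ha⟩ := h c
      refine visits_congr H (fun x hx => (ha x (H.mono le_rfl ?_ hx)).mono (by omega))
        (hg.visitsAll (((ha c (H.refl _ _ _)).marked_iff (by omega)).1 hc) Θ₁ hΘ₁)
      have := H.s_lt_r (k + 1)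
      omega

theorem good_congr {k : ℕ} (h : ∀ x, Agree k (Θ x) (Θ' x)) (hg : Good N s r q k Θ') :
    Good N s r q k Θ := by
  cases k with
  | zero => trivial
  | succ k => exact good_of_local H fun _ => ⟨Θ', hg, fun x _ => h x⟩

/-- Modifications of a good labeling on balls that are far from each other may be made at the same
time. -/
theorem good_patch {k n a : ℕ} (hkn : k ≤ n) {I : Set Γ}
    (hI : ∀ i ∈ I, ∀ j ∈ I, N n (2 * a + 2 * r k) i j → i = j)
    (hΘ : Good N s r q (k + 1) Θ) {Θi : Γ → Γ → Label F}
    (hΘi : ∀ i ∈ I, Good N s r q (k + 1) (Θi i))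
    (hout : ∀ i ∈ I, ∀ x, N n (a + 2 * r k) i x → ¬ N n a i x → Agree (k + 1) (Θi i x) (Θ x))
    (hin' : ∀ i ∈ I, ∀ x, N n a i x → Agree (k + 1) (Θ' x) (Θi i x))
    (hout' : ∀ x, (∀ i ∈ I, ¬ N n a i x) → Agree (k + 1) (Θ' x) (Θ x)) :
    Good N s r q (k + 1) Θ' := by
  refine good_of_local H fun p => ?_
  by_cases hp : ∃ i ∈ I, ∃ x₀, N k (r k) p x₀ ∧ N n a i x₀
  · obtain ⟨i, hi, x₀, hpx₀, hix₀⟩ := hp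
    refine ⟨Θi i, hΘi i hi, fun x hx => ?_⟩
    have hix : N n (a + 2 * r k) i x := H.mono le_rfl (by omega)
      (H.trans (H.trans hix₀ (H.mono hkn le_rfl (H.symm hpx₀))) (H.mono hkn le_rfl hx))
    by_cases hia : N n a i x
    · exact hin' i hi x hia
    · refine (hout' x fun j hj hjx => hia ?_).trans (hout i hi x hix hia).symm
      have := hI i hi j hj (H.mono le_rfl (by omega) (H.trans hix (H.symm hjx)))
      rwa [this]
  · push Not at hp
    exact ⟨Θ, hΘ, fun x hx => hout' x fun i hi => hp i hi x hx⟩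

theorem cleanAt_shift {k : ℕ} (δ : Γ) (h : CleanAt N r q k Θ) : CleanAt N r q k (shift δ Θ) := by
  have hpre : ∀ x, x ∈ premarked q k (shift δ Θ) ↔ x * δ ∈ premarked q k Θ := by
    intro x
    cases k with
    | zero => exact Iff.rfl
    | succ k => exact Iff.rfl
  refine ⟨fun x y hne hxy => ?_, fun x hx => ?_, fun x hx => ?_⟩
  · exact h.proper _ _ (by simpa using hne) ((H.mul_right δ).2 hxy)
  · exact (hpre x).2 (h.subset hx)
  · obtain ⟨y, hy, hxy⟩ := h.maximal _ ((hpre x).1 hx)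
    refine ⟨y * δ⁻¹, ?_, ?_⟩
    · simpa [marked, shift] using hy
    · rw [← H.mul_right δ]
      simpa using hxy

theorem visits_shift {m : ℕ} (δ c : Γ) {Θ₁ : Γ → Label F} :
    Visits N s m (shift δ Θ) c Θ₁ ↔ Visits N s m Θ (c * δ) Θ₁ := by
  constructor
  · rintro ⟨ε, hε, h⟩
    exact ⟨ε * δ, (H.mul_right δ).2 hε, fun γ hγ => by simpa [shift, mul_assoc] using h γ hγ⟩
  · rintro ⟨ε, hε, h⟩
    refine ⟨ε * δ⁻¹, ?_, fun γ hγ => by simpa [shift, mul_assoc] using h γ hγ⟩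
    rw [← H.mul_right δ]
    simpa using hε

theorem good_shift {k : ℕ} (δ : Γ) (h : Good N s r q k Θ) : Good N s r q k (shift δ Θ) := by
  induction k with
  | zero => trivial
  | succ k ih =>
    cases k with
    | zero => exact cleanAt_shift H δ h
    | succ k =>
      exact ⟨ih h.1, cleanAt_shift H δ h.2.1,
        fun c hc Θ₁ hΘ₁ => (visits_shift H δ c).2 (h.2.2 (c * δ) hc Θ₁ hΘ₁)⟩

theorem visitsAll_shift {m : ℕ} (δ c : Γ) :
    VisitsAll N s r q m (shift δ Θ) c ↔ VisitsAll N s r q m Θ (c * δ) :=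
  forall₂_congr fun _ _ => visits_shift H δ c

theorem visitsAll_congr {m : ℕ} {c : Γ}
    (h : ∀ x, N (m + 1) (s (m + 1)) c x → Agree m (Θ' x) (Θ x)) (hv : VisitsAll N s r q m Θ c) :
    VisitsAll N s r q m Θ' c := fun Θ₁ hΘ₁ => visits_congr H h (hv Θ₁ hΘ₁)

/-- In a good labeling every point is close to a marked point. -/
theorem exists_marked_near {m : ℕ} (h : Good N s r q (m + 1) Θ) (x : Γ) :
    ∃ y ∈ marked q m Θ, N m (2 * r m) x y := by
  induction m with
  | zero =>
    obtain ⟨y, hy, hxy⟩ := h.cleanAt.maximal x trivial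
    exact ⟨y, hy, H.mono le_rfl (by omega) hxy⟩
  | succ m ih =>
    obtain ⟨y, hy, hxy⟩ := ih h.pred
    obtain ⟨z, hz, hyz⟩ := h.cleanAt.maximal y hy
    have := H.r_lt_r m
    exact ⟨z, hz, H.mono le_rfl (by omega) (H.trans (H.mono (Nat.le_succ m) le_rfl hxy) hyz)⟩

end Scale

end Labelings

section Extension

variable {F : ℕ → Type*} {Γ : Type*}
  {N : ℕ → ℕ → Γ → Γ → Prop} {s r : ℕ → ℕ} {q : ∀ m, F m} {Θ Θ' : Γ → Label F}

theorem exists_maximal_sparse {R : Γ → Γ → Prop} (hrefl : ∀ x, R x x) (hsymm : ∀ x y, R x y → R y x)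
    {T₀ P : Set Γ} (hTP : T₀ ⊆ P) (hT : ∀ x ∈ T₀, ∀ y ∈ T₀, R x y → x = y) :
    ∃ T, T₀ ⊆ T ∧ T ⊆ P ∧ (∀ x ∈ T, ∀ y ∈ T, R x y → x = y) ∧ ∀ x ∈ P, ∃ y ∈ T, R x y := by
  obtain ⟨T, hT₀, hmax⟩ := zorn_subset_nonempty
    {T : Set Γ | T ⊆ P ∧ ∀ x ∈ T, ∀ y ∈ T, R x y → x = y} (fun c hc hchain hne => by
      refine ⟨⋃₀ c, ⟨Set.sUnion_subset fun t ht => (hc ht).1, ?_⟩,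
        fun t ht => Set.subset_sUnion_of_mem ht⟩
      rintro x ⟨t, ht, hxt⟩ y ⟨u, hu, hyu⟩ hxy
      rcases hchain.total ht hu with h | h
      · exact (hc hu).2 x (h hxt) y hyu hxy
      · exact (hc ht).2 x hxt y (h hyu) hxy) T₀ ⟨hTP, hT⟩
  refine ⟨T, hT₀, hmax.prop.1, hmax.prop.2, fun x hx => ?_⟩
  by_contra! hno
  have hins : insert x T ∈ {T : Set Γ | T ⊆ P ∧ ∀ x ∈ T, ∀ y ∈ T, R x y → x = y} := by
    refine ⟨Set.insert_subset hx hmax.prop.1, ?_⟩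
    rintro a (rfl | ha) b (rfl | hb) hab
    · rfl
    · exact absurd hab (hno b hb)
    · exact absurd (hsymm _ _ hab) (hno a ha)
    · exact hmax.prop.2 a ha b hb hab
  have := hmax.le_of_ge hins (Set.subset_insert x T) (Set.mem_insert x T)
  exact hno x this (hrefl x)

/-- Greedy extension of a proper colouring to finitely many more vertices. -/
theorem exists_proper_extension {R : Γ → Γ → Prop} (hrefl : ∀ x, R x x)
    (hsymm : ∀ x y, R x y → R y x) {K : Type*} [Finite K] (hfin : ∀ x, {y | R x y}.Finite)
    (hcard : ∀ x, {y | R x y}.ncard < Nat.card K) (k₀ : K) {C U : Set Γ} (hU : U.Finite)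
    {g : Γ → K} (hg : ∀ x ∈ C, ∀ y ∈ C, x ≠ y → R x y → g x ≠ g y) :
    ∃ g' : Γ → K, (∀ x ∈ C, g' x = g x) ∧ (∀ x ∈ U, x ∉ C → g' x ≠ k₀) ∧
      ∀ x ∈ C ∪ U, ∀ y ∈ C ∪ U, x ≠ y → R x y → g' x ≠ g' y := by
  classical
  induction U, hU using Set.Finite.induction_on with
  | empty => exact ⟨g, fun _ _ => rfl, by simp, by simpa using hg⟩
  | @insert u U hu hU ih =>
    obtain ⟨g', hC, hk, hp⟩ := ih
    by_cases huC : u ∈ C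
    · refine ⟨g', hC, ?_, ?_⟩
      · rintro x (rfl | hx) hxC
        · exact absurd huC hxC
        · exact hk x hx hxC
      · have : C ∪ insert u U = C ∪ U := by
          rw [Set.union_insert, Set.insert_eq_of_mem (show u ∈ C ∪ U from Or.inl huC)]
        rwa [this]
    · have hex : ∃ c, c ∉ insert k₀ (g' '' ({y | R u y} \ {u})) := by
        by_contra! hall
        have h1 : (insert k₀ (g' '' ({y | R u y} \ {u}))).ncard = Nat.card K := by
          rw [Set.eq_univ_of_forall hall, Set.ncard_univ]
        have h2 := Set.ncard_insert_le k₀ (g' '' ({y | R u y} \ {u}))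
        have h3 := Set.ncard_image_le (f := g') ((hfin u).sdiff (t := {u}))
        have h4 : ({y | R u y} \ {u}).ncard + 1 = {y | R u y}.ncard :=
          Set.ncard_sdiff_singleton_add_one (show R u u from hrefl u) (hfin u)
        have := hcard u
        omega
      obtain ⟨c, hc⟩ := hex
      rw [Set.mem_insert_iff, not_or] at hc
      have hcR : ∀ y, y ≠ u → R u y → c ≠ g' y := fun y hy hR h =>
        hc.2 ⟨y, ⟨hR, hy⟩, h.symm⟩
      refine ⟨Function.update g' u c, fun x hx => ?_, ?_, ?_⟩
      · rw [Function.update_of_ne (by rintro rfl; exact huC hx), hC x hx]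
      · rintro x (rfl | hx) hxC
        · simpa using hc.1
        · rw [Function.update_of_ne (by rintro rfl; exact hu hx)]
          exact hk x hx hxC
      · intro x hx y hy hxy hR
        rw [Set.union_insert] at hx hy
        by_cases hxu : x = u
        · subst hxu
          rw [Function.update_self, Function.update_of_ne (Ne.symm hxy)]
          exact hcR y (Ne.symm hxy) hR
        · by_cases hyu : y = u
          · subst hyu
            rw [Function.update_self, Function.update_of_ne hxy]
            exact (hcR x hxy (hsymm _ _ hR)).symm
          · rw [Function.update_of_ne hxu, Function.update_of_ne hyu]
            exact hp x (hx.resolve_left hxu) y (hy.resolve_left hyu) hxy hR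

variable [Group Γ]

/-- The width of the zone in which two good labelings are glued. -/
def glueRadius (s r : ℕ → ℕ) (k : ℕ) : ℕ := ∑ j ∈ Finset.range k, (3 * r j + 4 * s j)

/-- Good labelings can be glued along the boundary of finite sets. -/
def Gluable (N : ℕ → ℕ → Γ → Γ → Prop) (s r : ℕ → ℕ) (q : ∀ m, F m) (k : ℕ) : Prop :=
  ∀ Θ Θ', Good N s r q k Θ → Good N s r q k Θ' → ∀ A : Set Γ, A.Finite →
    ∃ Θ'', Good N s r q k Θ'' ∧ (∀ x ∈ A, Agree k (Θ'' x) (Θ' x)) ∧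
      ∀ x, (∀ a ∈ A, ¬ N k (glueRadius s r k) a x) → Agree k (Θ'' x) (Θ x)

theorem gluable_zero : Gluable N s r q 0 := fun Θ _ _ _ _ _ =>
  ⟨Θ, trivial, fun _ _ => agree_zero _ _, fun _ _ => agree_zero _ _⟩

/-- Gluing labelings which are glued in the levels below `k` at the level `k`. -/
theorem exists_glue_level (H : IsScaleSystem N s r F) [∀ m, Finite (F m)] {k : ℕ}
    (hG : Gluable N s r q k) (hΘ : Good N s r q (k + 1) Θ) (hΘ' : Good N s r q (k + 1) Θ')
    {A : Set Γ} (hA : A.Finite) :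
    ∃ Θ'', Good N s r q k Θ'' ∧ CleanAt N r q k Θ'' ∧
      (∀ x, (∃ a ∈ A, N k (2 * s k) a x) → Agree (k + 1) (Θ'' x) (Θ' x)) ∧
      ∀ x, (∀ a ∈ A, ¬ N k (glueRadius s r k + 3 * r k + 2 * s k) a x) →
        Agree (k + 1) (Θ'' x) (Θ x) := by
  classical
  set R := glueRadius s r k with hR
  let B : ℕ → Set Γ := fun t => {x | ∃ a ∈ A, N k t a x}
  have hBfin : ∀ t, (B t).Finite := fun t =>
    (hA.biUnion fun a _ => H.finite k t a).subset fun x ⟨a, ha, hx⟩ => Set.mem_biUnion ha hx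
  have hBmono : ∀ {t u x}, t ≤ u → x ∈ B t → x ∈ B u := fun htu ⟨a, ha, hx⟩ =>
    ⟨a, ha, H.mono le_rfl htu hx⟩
  have hBstep : ∀ {t u x y v}, x ∈ B t → N k u x y → t + u ≤ v → y ∈ B v :=
    fun ⟨a, ha, hx⟩ hxy hv => ⟨a, ha, H.mono le_rfl hv (H.trans hx hxy)⟩
  obtain ⟨Θ₁, hΘ₁, hin, hout⟩ := hG Θ Θ' hΘ.pred hΘ'.pred (B (2 * s k + r k)) (hBfin _)
  have hout' : ∀ x, x ∉ B (2 * s k + r k + R) → Agree k (Θ₁ x) (Θ x) := fun x hx =>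
    hout x fun a ha hax => hx (hBstep ha hax le_rfl)
  -- the marked points of level `k`
  have hpre : ∀ {Θ₂ : Γ → Label F} {x}, Agree k (Θ₁ x) (Θ₂ x) →
      (x ∈ premarked q k Θ₁ ↔ x ∈ premarked q k Θ₂) := by
    intro Θ₂ x h
    cases k with
    | zero => exact Iff.rfl
    | succ k => exact h.marked_iff k.lt_succ_self
  set b := 2 * s k + 2 * r k + R with hb
  have hT₀ : marked q k Θ' ∩ B (2 * s k + r k) ∪ marked q k Θ \ B b ⊆ premarked q k Θ₁ := by
    rintro x (⟨hx, hxB⟩ | ⟨hx, hxB⟩)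
    · exact (hpre (hin x hxB)).2 (hΘ'.cleanAt.subset hx)
    · exact (hpre (hout' x fun h => hxB (hBmono (by omega) h))).2 (hΘ.cleanAt.subset hx)
  obtain ⟨T, hT₀T, hTP, hTsp, hTmax⟩ := exists_maximal_sparse (R := N k (r k)) (H.refl k _)
    (fun _ _ => H.symm) hT₀ (by
      rintro x (⟨hx, hxB⟩ | ⟨hx, hxB⟩) y (⟨hy, hyB⟩ | ⟨hy, hyB⟩) hxy
      · exact hΘ'.cleanAt.eq_of_near hx hy hxy
      · exact absurd (hBstep hxB hxy (by omega)) hyB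
      · exact absurd (hBstep hyB (H.symm hxy) (by omega)) hxB
      · exact hΘ.cleanAt.eq_of_near hx hy hxy)
  have hTin : ∀ x ∈ B (2 * s k), x ∈ T ↔ x ∈ marked q k Θ' := by
    intro x hx
    have hx' : x ∈ B (2 * s k + r k) := hBmono (by omega) hx
    refine ⟨fun hxT => ?_, fun hxT => hT₀T (Or.inl ⟨hxT, hx'⟩)⟩
    obtain ⟨y, hy, hxy⟩ := hΘ'.cleanAt.maximal x ((hpre (hin x hx')).1 (hTP hxT))
    have := hTsp x hxT y (hT₀T (Or.inl ⟨hy, hBstep hx hxy le_rfl⟩)) hxy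
    rwa [this]
  have hTout : ∀ x, x ∉ B (b + r k) → (x ∈ T ↔ x ∈ marked q k Θ) := by
    intro x hx
    refine ⟨fun hxT => ?_, fun hxT => hT₀T (Or.inr ⟨hxT, fun h => hx (hBmono (by omega) h)⟩)⟩
    obtain ⟨y, hy, hxy⟩ := hΘ.cleanAt.maximal x
      ((hpre (hout' x fun h => hx (hBmono (by omega) h))).1 (hTP hxT))
    have := hTsp x hxT y (hT₀T (Or.inr ⟨hy, fun h => hx (hBstep h (H.symm hxy) le_rfl)⟩)) hxy
    rwa [this]
  -- the other labels of level `k`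
  let g : Γ → F k := fun x => if x ∈ B (2 * s k) then (Θ' x).2 k else
    if x ∈ B (b + r k) then q k else (Θ x).2 k
  let C : Set Γ := B (2 * s k) ∪ (B (b + r k))ᶜ ∪ T
  have hgT : ∀ x ∈ C, (g x = q k ↔ x ∈ T) := by
    intro x hx
    by_cases h1 : x ∈ B (2 * s k)
    · simp only [g, if_pos h1]
      exact (hTin x h1).symm
    · by_cases h2 : x ∈ B (b + r k)
      · simp only [g, if_neg h1, if_pos h2, true_iff]
        exact hx.resolve_left (not_or.2 ⟨h1, not_not.2 h2⟩)
      · simp only [g, if_neg h1, if_neg h2]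
        exact (hTout x h2).symm
  have hgproper : ∀ x ∈ C, ∀ y ∈ C, x ≠ y → N k (r k) x y → g x ≠ g y := by
    intro x hx y hy hne hxy heq
    by_cases hxT : x ∈ T
    · have hyT := (hgT y hy).1 (heq ▸ (hgT x hx).2 hxT)
      exact hne (hTsp x hxT y hyT hxy)
    · have hyT : y ∉ T := fun h => hxT ((hgT x hx).1 (heq ▸ (hgT y hy).2 h))
      by_cases hx1 : x ∈ B (2 * s k)
      · have hy2 : y ∈ B (b + r k) := hBstep hx1 hxy (by omega)
        have hy1 : y ∈ B (2 * s k) := (hy.resolve_right hyT).resolve_right (not_not.2 hy2)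
        simp only [g, if_pos hx1, if_pos hy1] at heq
        exact hΘ'.cleanAt.proper x y hne hxy heq
      · have hx2 : x ∉ B (b + r k) := (hx.resolve_right hxT).resolve_left hx1
        have hy1 : y ∉ B (2 * s k) := fun h => hx2 (hBstep h (H.symm hxy) (by omega))
        have hy2 : y ∉ B (b + r k) := (hy.resolve_right hyT).resolve_left hy1
        simp only [g, if_neg hx1, if_neg hy1, if_neg hx2, if_neg hy2] at heq
        exact hΘ.cleanAt.proper x y hne hxy heq
  obtain ⟨g', hg'C, hg'q, hg'⟩ := exists_proper_extension (R := N k (r k)) (H.refl k _)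
    (fun _ _ => H.symm) (H.finite k _) (H.card_labels k) (q k) (hBfin (b + r k)) hgproper
  have hcover : ∀ x, x ∈ C ∪ B (b + r k) := fun x => by
    by_cases h : x ∈ B (b + r k)
    · exact Or.inr h
    · exact Or.inl (Or.inl (Or.inr h))
  have hg'T : ∀ x, g' x = q k ↔ x ∈ T := by
    intro x
    by_cases hx : x ∈ C
    · rw [hg'C x hx]
      exact hgT x hx
    · exact ⟨fun h => absurd h (hg'q x ((hcover x).resolve_left hx) hx),
        fun h => absurd (Or.inr h) hx⟩
  let Θ₂ : Γ → Label F := fun x =>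
    (Function.update (Θ₁ x).1 k (if x ∈ B (2 * s k) then (Θ' x).1 k else (Θ x).1 k),
      Function.update (Θ₁ x).2 k (g' x))
  have hΘ₂k : ∀ x, (Θ₂ x).2 k = g' x := fun x => by simp [Θ₂]
  have hΘ₂ : ∀ x, Agree k (Θ₂ x) (Θ₁ x) := fun x i hi => by
    simp [Θ₂, Function.update_of_ne hi.ne]
  have hmark : marked q k Θ₂ = T := Set.ext fun x => by
    show (Θ₂ x).2 k = q k ↔ _
    rw [hΘ₂k]
    exact hg'T x
  have hpre₂ : premarked q k Θ₂ = premarked q k Θ₁ := Set.ext fun x => (hpre (hΘ₂ x).symm).symm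
  refine ⟨Θ₂, good_congr H hΘ₂ hΘ₁, ⟨fun x y hne hxy => ?_, ?_, ?_⟩, fun x hx i hi => ?_,
    fun x hx i hi => ?_⟩
  · rw [hΘ₂k, hΘ₂k]
    exact hg' x (hcover x) y (hcover y) hne hxy
  · rw [hmark, hpre₂]
    exact hTP
  · rw [hmark, hpre₂]
    exact hTmax
  · rcases Nat.lt_succ_iff_lt_or_eq.1 hi with hi | rfl
    · exact (hΘ₂ x).trans (hin x (hBmono (show 2 * s k ≤ 2 * s k + r k by omega) hx)) i hi
    · refine ⟨by simp [Θ₂, show x ∈ B (2 * s i) from hx], ?_⟩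
      rw [hΘ₂k, hg'C x (Or.inl (Or.inl hx))]
      exact if_pos hx
  · have hx' : x ∉ B (b + r k) := fun h => by
      obtain ⟨a, ha, hax⟩ := hBmono (show b + r k ≤ R + 3 * r k + 2 * s k by omega) h
      exact hx a ha hax
    have hx2 : x ∉ B (2 * s k) := fun h => hx' (hBmono (by omega) h)
    rcases Nat.lt_succ_iff_lt_or_eq.1 hi with hi | rfl
    · exact (hΘ₂ x).trans (hout' x fun h => hx' (hBmono (by omega) h)) i hi
    · refine ⟨by simp [Θ₂, hx2], ?_⟩
      rw [hΘ₂k, hg'C x (Or.inl (Or.inr hx'))]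
      simp only [g, if_neg hx2, if_neg hx']

end Extension

section Repair

variable {F : ℕ → Type*} {Γ : Type*} [Group Γ]
  {N : ℕ → ℕ → Γ → Γ → Prop} {s r : ℕ → ℕ} {q : ∀ m, F m} {Θ Θ' : Γ → Label F}

theorem IsScaleSystem.glueRadius_le (H : IsScaleSystem N s r F) (k : ℕ) :
    4 * glueRadius s r k ≤ s k := by
  induction k with
  | zero => simp [glueRadius]
  | succ k ih =>
    rw [glueRadius, Finset.sum_range_succ, ← glueRadius]
    have := H.s_lt_r k
    have := H.r_lt_s k
    omega

/-- `Θ''` is obtained from `Θ` by changing bits and labels below `m` around `1` and near marked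
points of level `m`, in such a way that `1` visits all good patterns of level `m`. -/
structure IsCorrection (N : ℕ → ℕ → Γ → Γ → Prop) (s r : ℕ → ℕ) (q : ∀ m, F m) (m : ℕ)
    (Θ Θ'' : Γ → Label F) : Prop where
  good : Good N s r q (m + 1) Θ''
  visitsAll : VisitsAll N s r q m Θ'' 1
  high : ∀ x i, m ≤ i → (Θ'' x).1 i = (Θ x).1 i ∧ (Θ'' x).2 i = (Θ x).2 i
  near : ∀ x, Θ'' x ≠ Θ x → ¬ VisitsAll N s r q m Θ 1 ∧ N (m + 1) (s (m + 1)) 1 x ∧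
    ∃ δ ∈ marked q m Θ, N m (5 * s m) δ x

theorem exists_isCorrection_of_gluable (H : IsScaleSystem N s r F) [∀ m, Finite (F m)] {m : ℕ}
    (hG : Gluable N s r q m) (hΘ : Good N s r q (m + 1) Θ) :
    ∃ Θ'', IsCorrection N s r q m Θ Θ'' := by
  classical
  by_cases hvis : VisitsAll N s r q m Θ 1
  · exact ⟨Θ, hΘ, hvis, fun _ _ _ => ⟨rfl, rfl⟩, fun x hx => absurd rfl hx⟩
  obtain ⟨L, hL, hcard, hLdist, hLsep⟩ := H.net m (marked q m Θ) (exists_marked_near H hΘ)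
  obtain ⟨u, hu, hu2⟩ := H.exists_far m
  have hsr := H.s_lt_r m
  have hrs := H.r_lt_s m
  have hfin : Finite {γ // N m (s m / 2) 1 γ} := H.finite m (s m / 2) 1
  -- an injection of the patterns into `L`
  obtain ⟨e⟩ : Nonempty (PatternCode N s F m ↪ L) := by
    have := Fintype.ofFinite (PatternCode N s F m)
    refine Function.Embedding.nonempty_of_card_le ?_
    rw [← Nat.card_eq_fintype_card, Fintype.card_coe]
    exact hcard
  let code : (Γ → Label F) → PatternCode N s F m := fun Θ' γ =>
    (fun i => (Θ' γ).1 i, fun i => (Θ' γ).2 i)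
  have hP : ∀ δ : Γ, ∃ P, Good N s r q m P ∧
      ∀ Θ', Good N s r q m Θ' → (e (code Θ') : Γ) = δ → code P = code Θ' := by
    intro δ
    by_cases h : ∃ Θ', Good N s r q m Θ' ∧ (e (code Θ') : Γ) = δ
    · obtain ⟨P, hP, hPδ⟩ := h
      exact ⟨P, hP, fun Θ' _ h' => e.injective (Subtype.ext (hPδ.trans h'.symm))⟩
    · exact ⟨Θ, hΘ.pred, fun Θ' hΘ' h' => absurd ⟨Θ', hΘ', h'⟩ h⟩
  choose P hPgood hPcode using hP
  have hQ := fun δ : Γ => hG Θ (shift (u * δ)⁻¹ (P δ)) hΘ.pred (good_shift H _ (hPgood δ))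
    {x | N m (s m / 2) (u * δ) x} (H.finite m _ _)
  choose Q hQgood hQin hQout using hQ
  have hQout' : ∀ δ x, ¬ N m (s m) (u * δ) x → Agree m (Q δ x) (Θ x) := by
    refine fun δ x hx => hQout δ x fun a ha hax => hx ?_
    have := H.glueRadius_le m
    exact H.mono le_rfl (by omega) (H.trans ha hax)
  have huδ : ∀ δ, N m (3 * s m) δ (u * δ) := fun δ => (H.near_mul (x := δ)).1 hu
  have hsep : ∀ δ ∈ L, ∀ δ' ∈ L, N m (4 * s m) (u * δ) (u * δ') → δ = δ' := by
    intro δ hδ δ' hδ' h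
    refine hLsep δ hδ δ' hδ' (H.mono (Nat.le_succ m) ?_
      (H.trans (huδ δ) (H.trans h (H.symm (huδ δ')))))
    omega
  let Θ'' : Γ → Label F := fun x => if h : ∃ δ ∈ L, N m (s m) (u * δ) x then
    splice m (Q h.choose x) (Θ x) else Θ x
  have hin : ∀ δ ∈ L, ∀ x, N m (s m) (u * δ) x → Θ'' x = splice m (Q δ x) (Θ x) := by
    intro δ hδ x hx
    have h : ∃ δ ∈ L, N m (s m) (u * δ) x := ⟨δ, hδ, hx⟩
    have heq : h.choose = δ := hsep _ h.choose_spec.1 δ hδ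
      (H.mono le_rfl (by omega) (H.trans h.choose_spec.2 (H.symm hx)))
    simp only [Θ'', dif_pos h, heq]
  have hout : ∀ x, (∀ δ ∈ L, ¬ N m (s m) (u * δ) x) → Θ'' x = Θ x := by
    intro x hx
    exact dif_neg (by push Not; exact hx)
  have hhigh : ∀ x i, m ≤ i → (Θ'' x).1 i = (Θ x).1 i ∧ (Θ'' x).2 i = (Θ x).2 i := by
    intro x i hi
    by_cases h : ∃ δ ∈ L, N m (s m) (u * δ) x
    · obtain ⟨δ, hδ, hx⟩ := h
      rw [hin δ hδ x hx]
      exact ⟨splice_bit hi _ _, splice_level hi _ _⟩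
    · rw [hout x (by push Not at h; exact h)]
      exact ⟨rfl, rfl⟩
  have hfar : ∀ c ∈ marked q m Θ, ∀ x, N m (s m) c x → Θ'' x = Θ x := by
    refine fun c hc x hcx => hout x fun δ hδ hx => ?_
    have hcδ : c = δ := hΘ.cleanAt.eq_of_near hc (hL hδ)
      (H.mono le_rfl (by omega) (H.trans hcx (H.trans (H.symm hx) (H.symm (huδ δ)))))
    subst hcδ
    refine hu2 ((H.near_mul (x := c)).2 ?_)
    exact H.mono le_rfl (by omega) (H.trans hcx (H.symm hx))
  have hgood : Good N s r q m Θ'' := by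
    cases m with
    | zero => trivial
    | succ k =>
      have hrk := H.r_lt_s k
      refine good_patch H (a := s (k + 1)) (Nat.le_succ k) (I := (u * ·) '' L) ?_ hΘ.pred
        (Θi := fun i => Q (u⁻¹ * i)) (fun i _ => hQgood _) ?_ ?_ ?_
      · rintro _ ⟨δ, hδ, rfl⟩ _ ⟨δ', hδ', rfl⟩ h
        show u * δ = u * δ'
        rw [hsep δ hδ δ' hδ' (H.mono le_rfl (by omega) h)]
      · rintro _ ⟨δ, hδ, rfl⟩ x - hx
        simpa using hQout' δ x hx
      · rintro _ ⟨δ, hδ, rfl⟩ x hx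
        rw [hin δ hδ x hx]
        simpa using agree_splice (k + 1) (Q δ x) (Θ x)
      · exact fun x hx => Agree.of_eq (hout x fun δ hδ => hx _ ⟨δ, hδ, rfl⟩)
  have hmark : marked q m Θ'' = marked q m Θ := Set.ext fun x => by
    show (Θ'' x).2 m = q m ↔ (Θ x).2 m = q m
    rw [(hhigh x m le_rfl).2]
  have hpre : ∀ x, Θ'' x = Θ x → (x ∈ premarked q m Θ'' ↔ x ∈ premarked q m Θ) := fun x hx =>
    (Agree.of_eq (m := m + 1) hx).premarked_iff m.lt_succ_self
  have hclean : CleanAt N r q m Θ'' := by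
    refine ⟨fun x y hne hxy => ?_, fun x hx => ?_, fun x hx => ?_⟩
    · rw [(hhigh x m le_rfl).2, (hhigh y m le_rfl).2]
      exact hΘ.cleanAt.proper x y hne hxy
    · rw [hmark] at hx
      exact (hpre x (hfar x hx x (H.refl _ _ _))).2 (hΘ.cleanAt.subset hx)
    · rw [hmark]
      by_cases h : ∃ δ ∈ L, N m (s m) (u * δ) x
      · obtain ⟨δ, hδ, hδx⟩ := h
        exact ⟨δ, hL hδ, H.mono le_rfl (by omega) (H.trans (H.symm hδx) (H.symm (huδ δ)))⟩
      · exact hΘ.cleanAt.maximal x ((hpre x (hout x (by push Not at h; exact h))).1 hx)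
  have hgood' : Good N s r q (m + 1) Θ'' := by
    cases m with
    | zero => exact hclean
    | succ k =>
      refine ⟨hgood, hclean, fun c hc => ?_⟩
      rw [hmark] at hc
      exact visitsAll_congr H (fun x hx => Agree.of_eq (hfar c hc x hx)) (hΘ.visitsAll hc)
  have hdist : ∀ δ ∈ L, N (m + 1) (2 * s (m + 1) / 3 + 3 * s m) 1 (u * δ) := fun δ hδ =>
    H.trans (hLdist δ hδ) (H.mono (Nat.le_succ m) le_rfl (huδ δ))
  refine ⟨Θ'', hgood', fun Θ' hΘ' => ?_, hhigh, fun x hx => ⟨hvis, ?_⟩⟩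
  · obtain ⟨δ, hδ⟩ : ∃ δ : Γ, (e (code Θ') : Γ) = δ := ⟨_, rfl⟩
    have hδL : δ ∈ L := hδ ▸ (e (code Θ')).2
    refine ⟨u * δ, H.mono le_rfl (by omega) (hdist δ hδL), fun γ hγ => ?_⟩
    have hγ' : N m (s m / 2) (u * δ) (γ * (u * δ)) := H.near_mul.1 hγ
    rw [hin δ hδL _ (H.mono le_rfl (by omega) hγ')]
    refine (agree_splice _ _ _).trans ((hQin δ _ hγ').trans ?_)
    have := congrFun (hPcode δ Θ' hΘ' hδ) ⟨γ, hγ⟩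
    intro i hi
    simp only [shift, mul_inv_cancel_right]
    exact ⟨congrFun (congrArg Prod.fst this) ⟨i, hi⟩, congrFun (congrArg Prod.snd this) ⟨i, hi⟩⟩
  · have h : ∃ δ ∈ L, N m (s m) (u * δ) x := by
      by_contra h
      exact hx (hout x (by push Not at h; exact h))
    obtain ⟨δ, hδ, hδx⟩ := h
    exact ⟨H.mono le_rfl (by omega) (H.trans (hdist δ hδ) (H.mono (Nat.le_succ m) le_rfl hδx)),
      δ, hL hδ, H.mono le_rfl (by omega) (H.trans (huδ δ) hδx)⟩

/-- `Θ` and `Θ₀` agree on the part of `Γ` on which the correction at `1` depends. -/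
def SameWindow (N : ℕ → ℕ → Γ → Γ → Prop) (s r : ℕ → ℕ) (m : ℕ) (Θ Θ₀ : Γ → Label F) : Prop :=
  ∀ x, N (m + 1) (s (m + 1) + 2 * r m) 1 x → Agree (m + 1) (Θ x) (Θ₀ x)

/-- A correction which depends on finitely many labels only. -/
noncomputable def correction (N : ℕ → ℕ → Γ → Γ → Prop) (s r : ℕ → ℕ) (q : ∀ m, F m) (m : ℕ)
    (Θ : Γ → Label F) : Γ → Label F :=
  @Classical.epsilon _ ⟨fun _ => (fun _ => false, q)⟩ fun Θ'' =>
    ∃ Θ₀, Good N s r q (m + 1) Θ₀ ∧ SameWindow N s r m Θ Θ₀ ∧ IsCorrection N s r q m Θ₀ Θ''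

open Classical in
/-- The labeling `Θ`, corrected around `1`. -/
noncomputable def corrected (N : ℕ → ℕ → Γ → Γ → Prop) (s r : ℕ → ℕ) (q : ∀ m, F m) (m : ℕ)
    (Θ : Γ → Label F) : Γ → Label F := fun x =>
  if N (m + 1) (s (m + 1)) 1 x then splice m (correction N s r q m Θ x) (Θ x) else Θ x

theorem corrected_high (m : ℕ) (Θ : Γ → Label F) (x : Γ) {i : ℕ} (hi : m ≤ i) :
    (corrected N s r q m Θ x).1 i = (Θ x).1 i ∧ (corrected N s r q m Θ x).2 i = (Θ x).2 i := by
  unfold corrected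
  split_ifs
  · exact ⟨splice_bit hi _ _, splice_level hi _ _⟩
  · exact ⟨rfl, rfl⟩

theorem corrected_agree {m : ℕ} (h : SameWindow N s r m Θ Θ') {x : Γ}
    (hx : N (m + 1) (s (m + 1)) 1 x) :
    Agree m (corrected N s r q m Θ x) (corrected N s r q m Θ' x) := by
  have heq : correction N s r q m Θ = correction N s r q m Θ' := by
    unfold correction
    congr 1
    refine funext fun Θ'' => propext (exists_congr fun Θ₀ => ?_)
    refine and_congr_right fun _ => and_congr_left fun _ => ?_
    exact ⟨fun h' y hy => (h y hy).symm.trans (h' y hy), fun h' y hy => (h y hy).trans (h' y hy)⟩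
  simp only [corrected, if_pos hx, heq]
  exact (agree_splice _ _ _).trans (agree_splice _ _ _).symm

theorem isCorrection_corrected (H : IsScaleSystem N s r F) [∀ m, Finite (F m)] {m : ℕ}
    (hG : Gluable N s r q m) (hΘ : Good N s r q (m + 1) Θ) :
    IsCorrection N s r q m Θ (corrected N s r q m Θ) := by
  obtain ⟨Θ₀, hΘ₀, hw, hc⟩ : ∃ Θ₀, Good N s r q (m + 1) Θ₀ ∧ SameWindow N s r m Θ Θ₀ ∧
      IsCorrection N s r q m Θ₀ (correction N s r q m Θ) := by
    obtain ⟨Θ'', hΘ''⟩ := exists_isCorrection_of_gluable H hG hΘ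
    exact Classical.epsilon_spec_aux _ (fun Θ'' => ∃ Θ₀, Good N s r q (m + 1) Θ₀ ∧
      SameWindow N s r m Θ Θ₀ ∧ IsCorrection N s r q m Θ₀ Θ'')
      ⟨Θ'', Θ, hΘ, fun _ _ => Agree.refl _ _, hΘ''⟩
  have hsr := H.s_lt_r m
  have hin : ∀ x, N (m + 1) (s (m + 1)) 1 x →
      Agree (m + 1) (corrected N s r q m Θ x) (correction N s r q m Θ x) := by
    intro x hx i hi
    rcases Nat.lt_succ_iff_lt_or_eq.1 hi with hi | rfl
    · simp only [corrected, if_pos hx]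
      exact agree_splice _ _ _ i hi
    · have h1 := corrected_high (N := N) (s := s) (r := r) (q := q) i Θ x le_rfl
      have h2 := hw x (H.mono le_rfl (by omega) hx) i i.lt_succ_self
      have h3 := hc.high x i le_rfl
      exact ⟨h1.1.trans (h2.1.trans h3.1.symm), h1.2.trans (h2.2.trans h3.2.symm)⟩
  have hout : ∀ x, ¬ N (m + 1) (s (m + 1)) 1 x → corrected N s r q m Θ x = Θ x :=
    fun x hx => if_neg hx
  have hout₀ : ∀ x, ¬ N (m + 1) (s (m + 1)) 1 x → correction N s r q m Θ x = Θ₀ x := by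
    intro x hx
    by_contra hne
    exact hx (hc.near x hne).2.1
  refine ⟨?_, ?_, fun x i hi => corrected_high m Θ x hi, fun x hx => ?_⟩
  · refine good_patch H (Nat.le_succ m) (a := s (m + 1)) (I := {1})
      (fun i hi j hj _ => by rw [Set.mem_singleton_iff.1 hi, Set.mem_singleton_iff.1 hj]) hΘ
      (Θi := fun _ => correction N s r q m Θ) (fun _ _ => hc.good) ?_ ?_ ?_
    · rintro _ rfl x hx hx'
      rw [hout₀ x hx']
      exact (hw x hx).symm
    · rintro _ rfl x hx
      exact hin x hx
    · exact fun x hx => Agree.of_eq (hout x (hx 1 rfl))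
  · exact visitsAll_congr H (fun x hx => (hin x hx).mono (Nat.le_succ m)) hc.visitsAll
  · have hx1 : N (m + 1) (s (m + 1)) 1 x := by
      by_contra h
      exact hx (hout x h)
    have hne : correction N s r q m Θ x ≠ Θ₀ x := by
      intro h
      refine hx ?_
      simp only [corrected, if_pos hx1]
      refine splice_eq_of_agree ?_
      rw [h]
      exact (hw x (H.mono le_rfl (by omega) hx1)).symm.mono (Nat.le_succ m)
    obtain ⟨hv, -, δ, hδ, hδx⟩ := hc.near x hne
    refine ⟨fun h => hv (visitsAll_congr H (fun y hy => ?_) h), hx1, δ, ?_, hδx⟩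
    · exact (hw y (H.mono le_rfl (by omega) hy)).symm.mono (Nat.le_succ m)
    · refine ((hw δ (H.mono le_rfl ?_ (H.trans hx1 (H.symm (H.mono (Nat.le_succ m) le_rfl
        hδx))))).marked_iff m.lt_succ_self).2 hδ
      omega

/-- The position, seen from `1`, of a marked point of level `m + 1` close to `1`. -/
noncomputable def markedCenter (N : ℕ → ℕ → Γ → Γ → Prop) (s : ℕ → ℕ) (q : ∀ m, F m) (m : ℕ)
    (Θ : Γ → Label F) : Γ :=
  Classical.epsilon fun γ => N (m + 1) (s (m + 1)) 1 γ ∧ γ ∈ marked q (m + 1) Θ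

open Classical in
/-- The label at `1` after correction around all marked points of level `m + 1`. -/
noncomputable def repairAt (N : ℕ → ℕ → Γ → Γ → Prop) (s r : ℕ → ℕ) (q : ∀ m, F m) (m : ℕ)
    (Θ : Γ → Label F) : Label F :=
  if ∃ γ, N (m + 1) (s (m + 1)) 1 γ ∧ γ ∈ marked q (m + 1) Θ then
    corrected N s r q m (shift (markedCenter N s q m Θ) Θ) (markedCenter N s q m Θ)⁻¹
  else Θ 1

/-- The labeling `Θ`, corrected around all marked points of level `m + 1`. -/
noncomputable def repair (N : ℕ → ℕ → Γ → Γ → Prop) (s r : ℕ → ℕ) (q : ∀ m, F m) (m : ℕ)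
    (Θ : Γ → Label F) : Γ → Label F := fun x => repairAt N s r q m (shift x Θ)

theorem repairAt_high (m : ℕ) (Θ : Γ → Label F) {i : ℕ} (hi : m ≤ i) :
    (repairAt N s r q m Θ).1 i = (Θ 1).1 i ∧ (repairAt N s r q m Θ).2 i = (Θ 1).2 i := by
  unfold repairAt
  split_ifs
  · simpa [shift] using corrected_high (N := N) (s := s) (r := r) (q := q) m
      (shift (markedCenter N s q m Θ) Θ) (markedCenter N s q m Θ)⁻¹ hi
  · exact ⟨rfl, rfl⟩

theorem repair_high (m : ℕ) (Θ : Γ → Label F) (x : Γ) {i : ℕ} (hi : m ≤ i) :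
    (repair N s r q m Θ x).1 i = (Θ x).1 i ∧ (repair N s r q m Θ x).2 i = (Θ x).2 i := by
  simpa [repair, shift] using repairAt_high (N := N) (s := s) (r := r) (q := q) m (shift x Θ) hi

theorem repairAt_agree (H : IsScaleSystem N s r F) {m : ℕ}
    (h : ∀ x, N (m + 1) (r (m + 1)) 1 x → Agree (m + 2) (Θ x) (Θ' x)) :
    Agree m (repairAt N s r q m Θ) (repairAt N s r q m Θ') := by
  have hsr := H.s_lt_r (m + 1)
  have hrs := H.r_lt_s m
  have hpred : (fun γ => N (m + 1) (s (m + 1)) 1 γ ∧ γ ∈ marked q (m + 1) Θ) =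
      fun γ => N (m + 1) (s (m + 1)) 1 γ ∧ γ ∈ marked q (m + 1) Θ' := by
    refine funext fun γ => propext (and_congr_right fun hγ => ?_)
    exact (h γ (H.mono le_rfl (by omega) hγ)).marked_iff (Nat.lt_succ_self _)
  have hcen : markedCenter N s q m Θ = markedCenter N s q m Θ' := by
    unfold markedCenter
    rw [hpred]
  by_cases hex : ∃ γ, N (m + 1) (s (m + 1)) 1 γ ∧ γ ∈ marked q (m + 1) Θ
  · have hex' : ∃ γ, N (m + 1) (s (m + 1)) 1 γ ∧ γ ∈ marked q (m + 1) Θ' := by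
      rwa [hpred] at hex
    have hc : N (m + 1) (s (m + 1)) 1 (markedCenter N s q m Θ') :=
      (Classical.epsilon_spec hex').1
    simp only [repairAt, if_pos hex, if_pos hex', hcen]
    refine corrected_agree (fun x hx => ?_) ?_
    · exact (h _ (H.mono le_rfl (by omega) (H.trans hc (H.near_mul.1 hx)))).mono (Nat.le_succ _)
    · rw [← one_mul (markedCenter N s q m Θ')⁻¹, H.near_mul_inv]
      exact H.symm hc
  · have hex' : ¬ ∃ γ, N (m + 1) (s (m + 1)) 1 γ ∧ γ ∈ marked q (m + 1) Θ' := by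
      rwa [hpred] at hex
    simp only [repairAt, if_neg hex, if_neg hex']
    exact (h 1 (H.refl _ _ _)).mono (by omega)

theorem repair_eq_corrected (H : IsScaleSystem N s r F) {m : ℕ} (hΘ : CleanAt N r q (m + 1) Θ)
    {c x : Γ} (hc : c ∈ marked q (m + 1) Θ) (hx : N (m + 1) (s (m + 1)) c x) :
    repair N s r q m Θ x = corrected N s r q m (shift c Θ) (x * c⁻¹) := by
  have hex : ∃ γ, N (m + 1) (s (m + 1)) 1 γ ∧ γ ∈ marked q (m + 1) (shift x Θ) :=
    ⟨c * x⁻¹, H.near_mul_inv.2 (H.symm hx), by simpa [marked, shift] using hc⟩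
  obtain ⟨h1, h2⟩ : N (m + 1) (s (m + 1)) 1 (markedCenter N s q m (shift x Θ)) ∧
      markedCenter N s q m (shift x Θ) ∈ marked q (m + 1) (shift x Θ) :=
    Classical.epsilon_spec hex
  set γ := markedCenter N s q m (shift x Θ) with hγ
  have heq : c = γ * x := hΘ.eq_of_near hc h2 (H.mono le_rfl
    (by have := H.s_lt_r (m + 1); omega) (H.trans hx (H.near_mul.1 h1)))
  have hshift : shift γ (shift x Θ) = shift c Θ := by
    funext y
    simp [shift, heq, mul_assoc]
  rw [repair, repairAt, if_pos hex, ← hγ, hshift, heq]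
  simp

theorem repair_eq_of_forall (H : IsScaleSystem N s r F) {m : ℕ} {x : Γ}
    (hx : ∀ c ∈ marked q (m + 1) Θ, ¬ N (m + 1) (s (m + 1)) c x) :
    repair N s r q m Θ x = Θ x := by
  rw [repair, repairAt, if_neg]
  · simp [shift]
  · rintro ⟨γ, hγ, hm⟩
    exact hx (γ * x) hm (H.symm (H.near_mul.1 hγ))

theorem of_repair_ne (H : IsScaleSystem N s r F) [∀ m, Finite (F m)] {m : ℕ}
    (hG : Gluable N s r q m) (hΘ : Good N s r q (m + 1) Θ) (hΘ' : CleanAt N r q (m + 1) Θ) {x : Γ}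
    (hx : repair N s r q m Θ x ≠ Θ x) :
    (∃ c ∈ marked q (m + 1) Θ, N (m + 1) (s (m + 1)) c x ∧ ¬ VisitsAll N s r q m Θ c) ∧
      ∃ δ ∈ marked q m Θ, N m (5 * s m) δ x := by
  obtain ⟨c, hc, hcx⟩ : ∃ c ∈ marked q (m + 1) Θ, N (m + 1) (s (m + 1)) c x := by
    by_contra! h
    exact hx (repair_eq_of_forall H h)
  rw [repair_eq_corrected H hΘ' hc hcx] at hx
  obtain ⟨hv, -, δ, hδ, hδx⟩ := (isCorrection_corrected H hG (good_shift H c hΘ)).near (x * c⁻¹)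
    (by simpa [shift] using hx)
  rw [visitsAll_shift H, one_mul] at hv
  refine ⟨⟨c, hc, hcx, hv⟩, δ * c, hδ, ?_⟩
  rw [← H.mul_right c⁻¹]
  simpa using hδx

theorem good_repair (H : IsScaleSystem N s r F) [∀ m, Finite (F m)] {m : ℕ}
    (hG : Gluable N s r q m) (hΘ : Good N s r q (m + 1) Θ) (hΘ' : CleanAt N r q (m + 1) Θ) :
    Good N s r q (m + 2) (repair N s r q m Θ) := by
  have hsr := H.s_lt_r (m + 1)
  have hrs := H.r_lt_s m
  have hcorr := fun c => isCorrection_corrected H hG (good_shift H c hΘ)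
  let Θi : Γ → Γ → Label F := fun c => shift c⁻¹ (corrected N s r q m (shift c Θ))
  have hin : ∀ c ∈ marked q (m + 1) Θ, ∀ x, N (m + 1) (s (m + 1)) c x →
      repair N s r q m Θ x = Θi c x := fun c hc x hx => repair_eq_corrected H hΘ' hc hx
  have hlevel : ∀ i, m ≤ i → marked q i (repair N s r q m Θ) = marked q i Θ := fun i hi =>
    Set.ext fun x => by
      show (repair N s r q m Θ x).2 i = q i ↔ (Θ x).2 i = q i
      rw [(repair_high m Θ x hi).2]
  refine ⟨?_, cleanAt_congr (fun x => (repair_high m Θ x (Nat.le_succ m)).2)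
    (hlevel m le_rfl) hΘ', fun c hc => ?_⟩
  · refine good_patch H (Nat.le_succ m) (a := s (m + 1)) (I := marked q (m + 1) Θ)
      (fun i hi j hj hij => hΘ'.eq_of_near hi hj (H.mono le_rfl (by omega) hij)) hΘ
      (Θi := Θi) (fun c _ => good_shift H _ (hcorr c).good) (fun c hc x _ hx => Agree.of_eq ?_)
      (fun c hc x hx => Agree.of_eq (hin c hc x hx))
      (fun x hx => Agree.of_eq (repair_eq_of_forall H hx))
    by_contra hne
    have := ((hcorr c).near (x * c⁻¹) (by simpa [Θi, shift] using hne)).2.1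
    exact hx (H.near_mul_inv.1 this)
  · rw [hlevel _ (Nat.le_succ m)] at hc
    refine visitsAll_congr H (fun x hx => Agree.of_eq (hin c hc x hx)) ?_
    rw [visitsAll_shift H, mul_inv_cancel]
    exact (hcorr c).visitsAll

theorem glueRadius_succ (s r : ℕ → ℕ) (k : ℕ) :
    glueRadius s r (k + 1) = glueRadius s r k + (3 * r k + 4 * s k) := Finset.sum_range_succ _ _

theorem gluable (H : IsScaleSystem N s r F) [∀ m, Finite (F m)] :
    ∀ k, Gluable N s r q k
  | 0 => gluable_zero
  | 1 => fun Θ Θ' hΘ hΘ' A hA => by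
    obtain ⟨Θ₂, -, hc, hin, hout⟩ := exists_glue_level H gluable_zero hΘ hΘ' hA
    refine ⟨Θ₂, hc, fun x hx => hin x ⟨x, hx, H.refl _ _ _⟩, fun x hx => hout x fun a ha hax => ?_⟩
    refine hx a ha (H.mono (Nat.le_succ 0) ?_ hax)
    rw [glueRadius_succ]
    omega
  | m + 2 => fun Θ Θ' hΘ hΘ' A hA => by
    obtain ⟨Θ₂, hg, hc, hin, hout⟩ := exists_glue_level H (gluable H (m + 1)) hΘ hΘ' hA
    refine ⟨repair N s r q m Θ₂, good_repair H (gluable H m) hg hc, fun x hx => ?_, fun x hx => ?_⟩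
    · have hx2 : Agree (m + 2) (Θ₂ x) (Θ' x) := hin x ⟨x, hx, H.refl _ _ _⟩
      by_cases hne : repair N s r q m Θ₂ x = Θ₂ x
      · rwa [hne]
      · obtain ⟨⟨c, hcm, hcx, hv⟩, -⟩ := of_repair_ne H (gluable H m) hg hc hne
        have hin' : ∀ y, N (m + 1) (s (m + 1)) c y → Agree (m + 2) (Θ₂ y) (Θ' y) := fun y hy =>
          hin y ⟨x, hx, H.mono le_rfl (by omega) (H.trans (H.symm hcx) hy)⟩
        refine absurd (visitsAll_congr H (fun y hy => (hin' y hy).mono (by omega))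
          (hΘ'.visitsAll ?_)) hv
        exact ((hin' c (H.refl _ _ _)).marked_iff (Nat.lt_succ_self _)).1 hcm
    · have hrad : glueRadius s r (m + 2) = _ := glueRadius_succ s r (m + 1)
      have hx2 : Agree (m + 2) (Θ₂ x) (Θ x) := hout x fun a ha hax => hx a ha
        (H.mono (Nat.le_succ _) (by omega) hax)
      by_cases hne : repair N s r q m Θ₂ x = Θ₂ x
      · rwa [hne]
      · obtain ⟨⟨c, hcm, hcx, hv⟩, -⟩ := of_repair_ne H (gluable H m) hg hc hne
        have hout' : ∀ y, N (m + 1) (s (m + 1)) c y → Agree (m + 2) (Θ₂ y) (Θ y) := fun y hy =>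
          hout y fun a ha hay => hx a ha (H.mono (Nat.le_succ _) (by omega)
            (H.trans hay (H.trans (H.symm hy) hcx)))
        refine absurd (visitsAll_congr H (fun y hy => (hout' y hy).mono (by omega))
          (hΘ.visitsAll ?_)) hv
        exact ((hout' c (H.refl _ _ _)).marked_iff (Nat.lt_succ_self _)).1 hcm

end Repair

section Clopen

variable {Γ : Type*} [Group Γ] {ζ : Γ →* (Cantor ≃ₜ Cantor)}

theorem apply_mul (ζ : Γ →* (Cantor ≃ₜ Cantor)) (γ δ : Γ) (x : Cantor) :
    ζ (γ * δ) x = ζ γ (ζ δ x) := by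
  rw [map_mul]; rfl

theorem apply_one (ζ : Γ →* (Cantor ≃ₜ Cantor)) (x : Cantor) : ζ 1 x = x := by
  rw [map_one]; rfl

theorem apply_inv_apply (ζ : Γ →* (Cantor ≃ₜ Cantor)) (γ : Γ) (x : Cantor) :
    ζ γ⁻¹ (ζ γ x) = x := by
  rw [← apply_mul, inv_mul_cancel, apply_one]

theorem exists_clopen_independent (hζ : IsFreeAction ζ) {K : Set Γ} (hK : K.Finite)
    (h1 : (1 : Γ) ∉ K) (x : Cantor) :
    ∃ V : Set Cantor, IsClopen V ∧ x ∈ V ∧ ∀ y ∈ V, ∀ γ ∈ K, ζ γ y ∉ V := by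
  have hU : ∀ γ ∈ K, ∃ U : Set Cantor, IsClopen U ∧ x ∈ U ∧ ζ γ x ∉ U := by
    intro γ hγ
    have hne : x ≠ ζ γ x := fun h => h1 (hζ γ x h.symm ▸ hγ)
    obtain ⟨U, hU, hx, hx'⟩ := exists_isClopen_of_totally_separated hne
    exact ⟨U, hU, hx, hx'⟩
  choose! U hUc hUx hUγ using hU
  refine ⟨⋂ γ ∈ K, U γ ∩ ζ γ ⁻¹' (U γ)ᶜ, hK.isClopen_biInter fun γ hγ =>
    (hUc γ hγ).inter ((hUc γ hγ).compl.preimage (ζ γ).continuous), ?_, fun y hy γ hγ hy' => ?_⟩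
  · exact Set.mem_iInter₂.2 fun γ hγ => ⟨hUx γ hγ, hUγ γ hγ⟩
  · exact (Set.mem_iInter₂.1 hy γ hγ).2 (Set.mem_iInter₂.1 hy' γ hγ).1

theorem exists_clopen_cover (hζ : IsFreeAction ζ) {K : Set Γ} (hK : K.Finite)
    (h1 : (1 : Γ) ∉ K) :
    ∃ (t : Finset Cantor) (V : Cantor → Set Cantor), (∀ v, IsClopen (V v)) ∧
      (∀ v, ∀ y ∈ V v, ∀ γ ∈ K, ζ γ y ∉ V v) ∧ ∀ x, ∃ v ∈ t, x ∈ V v := by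
  choose V hVc hVx hV using exists_clopen_independent hζ hK h1
  obtain ⟨t, -, ht⟩ := isCompact_univ.elim_nhds_subcover V
    fun x _ => (hVc x).isOpen.mem_nhds (hVx x)
  exact ⟨t, V, hVc, hV, fun x => by simpa using ht (Set.mem_univ x)⟩

/-- Greedy construction of a clopen maximal independent subset of a clopen set. -/
theorem exists_clopen_maximal (hζ : IsFreeAction ζ) {K : Set Γ} (hK : K.Finite)
    (h1 : (1 : Γ) ∉ K) (hinv : ∀ γ ∈ K, γ⁻¹ ∈ K) {A : Set Cantor} (hA : IsClopen A) :
    ∃ T ⊆ A, IsClopen T ∧ (∀ x ∈ T, ∀ γ ∈ K, ζ γ x ∉ T) ∧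
      ∀ x ∈ A, x ∈ T ∨ ∃ γ ∈ K, ζ γ x ∈ T := by
  classical
  obtain ⟨t, V, hVc, hV, hcover⟩ := exists_clopen_cover hζ hK h1
  have key : ∀ t : Finset Cantor, ∃ T ⊆ A, IsClopen T ∧ (∀ x ∈ T, ∀ γ ∈ K, ζ γ x ∉ T) ∧
      ∀ x ∈ A, (∃ v ∈ t, x ∈ V v) → x ∈ T ∨ ∃ γ ∈ K, ζ γ x ∈ T := by
    intro t
    induction t using Finset.induction_on with
    | empty => exact ⟨∅, Set.empty_subset _, isClopen_empty, by simp, by simp⟩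
    | insert v t _ ih =>
      obtain ⟨T, hTA, hTc, hTsp, hTmax⟩ := ih
      refine ⟨T ∪ (A ∩ V v) \ ⋃ γ ∈ K, ζ γ ⁻¹' T, Set.union_subset hTA fun x hx => hx.1.1,
        hTc.union ((hA.inter (hVc v)).diff (hK.isClopen_biUnion fun γ _ =>
          hTc.preimage (ζ γ).continuous)), ?_, ?_⟩
      · rintro x (hx | ⟨⟨hxA, hxV⟩, hxT⟩) γ hγ (hy | ⟨⟨hyA, hyV⟩, hyT⟩)
        · exact hTsp x hx γ hγ hy
        · refine hyT (Set.mem_biUnion (hinv γ hγ) ?_)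
          rwa [Set.mem_preimage, apply_inv_apply]
        · exact hxT (Set.mem_biUnion hγ hy)
        · exact hV v x hxV γ hγ hyV
      · rintro x hxA ⟨w, hw, hxw⟩
        rcases Finset.mem_insert.1 hw with rfl | hw
        · by_cases hx : x ∈ ⋃ γ ∈ K, ζ γ ⁻¹' T
          · obtain ⟨γ, hγ, hx⟩ := Set.mem_iUnion₂.1 hx
            exact Or.inr ⟨γ, hγ, Or.inl hx⟩
          · exact Or.inl (Or.inr ⟨⟨hxA, hxw⟩, hx⟩)
        · rcases hTmax x hxA ⟨w, hw, hxw⟩ with h | ⟨γ, hγ, h⟩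
          · exact Or.inl (Or.inl h)
          · exact Or.inr ⟨γ, hγ, Or.inl h⟩
  obtain ⟨T, hTA, hTc, hTsp, hTmax⟩ := key t
  exact ⟨T, hTA, hTc, hTsp, fun x hx => hTmax x hx (hcover x)⟩

/-- Greedy construction of a continuous proper colouring, one of whose colour classes is
prescribed. -/
theorem exists_continuous_coloring (hζ : IsFreeAction ζ) {K : Set Γ} (hK : K.Finite)
    (h1 : (1 : Γ) ∉ K) (hinv : ∀ γ ∈ K, γ⁻¹ ∈ K) {T : Set Cantor} (hT : IsClopen T)
    (hTsp : ∀ x ∈ T, ∀ γ ∈ K, ζ γ x ∉ T) {Y : Type*} [Finite Y] [TopologicalSpace Y]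
    [DiscreteTopology Y] (hcard : K.ncard + 1 < Nat.card Y) (c : Y) :
    ∃ g : Cantor → Y, Continuous g ∧ (∀ x, g x = c ↔ x ∈ T) ∧
      ∀ x, ∀ γ ∈ K, g x ≠ g (ζ γ x) := by
  classical
  obtain ⟨t, V, hVc, hV, hcover⟩ := exists_clopen_cover hζ hK h1
  have hKf : Finite K := hK
  have hpick : ∀ h : K → Y, ∃ y, y ≠ c ∧ ∀ γ, y ≠ h γ := by
    intro h
    by_contra! hall
    have h2 : insert c (Set.range h) = Set.univ := Set.eq_univ_of_forall fun y => by
      by_cases hy : y = c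
      · exact Or.inl hy
      · obtain ⟨γ, hγ⟩ := hall y hy
        exact Or.inr ⟨γ, hγ.symm⟩
    have h3 := Set.ncard_insert_le c (Set.range h)
    rw [h2, Set.ncard_univ, ← Set.image_univ] at h3
    have h4 := Set.ncard_image_le (f := h) (Set.finite_univ (α := K))
    rw [Set.ncard_univ] at h4
    have h5 : Nat.card K = K.ncard := rfl
    omega
  choose pick hpickc hpick using hpick
  have key : ∀ t : Finset Cantor, ∃ (C : Set Cantor) (g : Cantor → Y), IsClopen C ∧ T ⊆ C ∧
      (∀ v ∈ t, V v ⊆ C) ∧ Continuous g ∧ (∀ x, g x = c ↔ x ∈ T) ∧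
      ∀ x ∈ C, ∀ γ ∈ K, ζ γ x ∈ C → g x ≠ g (ζ γ x) := by
    intro t
    induction t using Finset.induction_on with
    | empty =>
      have : Nontrivial Y := Finite.one_lt_card_iff_nontrivial.1 (by omega)
      obtain ⟨c', hc'⟩ := exists_ne c
      refine ⟨T, fun x => if x ∈ T then c else c', hT, le_rfl, by simp, ?_, fun x => ?_,
        fun x hx γ hγ hx' => absurd hx' (hTsp x hx γ hγ)⟩
      · exact Continuous.if (by simp [hT.frontier_eq]) continuous_const continuous_const
      · by_cases hx : x ∈ T <;> simp [hx, hc']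
    | insert v t _ ih =>
      obtain ⟨C, g, hC, hTC, htC, hg, hgc, hgp⟩ := ih
      let g' : Cantor → Y := fun x => if x ∈ V v \ C then pick fun γ => g (ζ γ x) else g x
      have hg'new : ∀ x ∈ V v \ C, g' x = pick fun γ => g (ζ γ x) := fun x hx => if_pos hx
      have hg'old : ∀ x ∈ C, g' x = g x := fun x hx => if_neg fun h => h.2 hx
      refine ⟨C ∪ V v, g', hC.union (hVc v), hTC.trans Set.subset_union_left, ?_, ?_, ?_, ?_⟩
      · intro w hw
        rcases Finset.mem_insert.1 hw with rfl | hw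
        · exact Set.subset_union_right
        · exact (htC w hw).trans Set.subset_union_left
      · refine Continuous.if (fun a ha => ?_) ?_ hg
        · have ha' : a ∈ frontier (V v \ C) := ha
          rw [((hVc v).diff hC).frontier_eq] at ha'
          exact ha'.elim
        exact (continuous_of_discreteTopology (f := pick)).comp
          (continuous_pi fun γ => hg.comp (ζ γ).continuous)
      · intro x
        by_cases hx : x ∈ V v \ C
        · rw [hg'new x hx]
          exact ⟨fun h => absurd h (hpickc _), fun h => absurd (hTC h) hx.2⟩
        · simp only [g', if_neg hx]
          exact hgc x
      · intro x hx γ hγ hy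
        by_cases hxC : x ∈ C
        · by_cases hyC : ζ γ x ∈ C
          · rw [hg'old x hxC, hg'old _ hyC]
            exact hgp x hxC γ hγ hyC
          · rw [hg'old x hxC, hg'new _ ⟨hy.resolve_left hyC, hyC⟩]
            have := hpick (fun δ : K => g (ζ δ (ζ γ x))) ⟨γ⁻¹, hinv γ hγ⟩
            simp only [apply_inv_apply] at this
            exact this.symm
        · have hxV := hx.resolve_left hxC
          rw [hg'new x ⟨hxV, hxC⟩, hg'old _ (hy.resolve_right (hV v x hxV γ hγ))]
          exact hpick _ ⟨γ, hγ⟩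
  obtain ⟨C, g, -, -, htC, hg, hgc, hgp⟩ := key t
  have hC : ∀ x, x ∈ C := fun x => by
    obtain ⟨v, hv, hx⟩ := hcover x
    exact htC v hv hx
  exact ⟨g, hg, hgc, fun x γ hγ => hgp x (hC x) γ hγ (hC _)⟩

end Clopen

section Orbit

variable {Γ : Type*} [Group Γ] {F : ℕ → Type*} {ζ : Γ →* (Cantor ≃ₜ Cantor)}
  {N : ℕ → ℕ → Γ → Γ → Prop} {s r : ℕ → ℕ} {q : ∀ m, F m}

/-- The labeling of the group obtained by reading the labels along the orbit of `x`. -/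
def orbitLabeling (ζ : Γ →* (Cantor ≃ₜ Cantor)) (S : Cantor → Label F) (x : Cantor) :
    Γ → Label F := fun γ => S (ζ γ x)

theorem shift_orbitLabeling (S : Cantor → Label F) (δ : Γ) (x : Cantor) :
    shift δ (orbitLabeling ζ S x) = orbitLabeling ζ S (ζ δ x) := by
  funext γ
  simp [shift, orbitLabeling]

/-- There is a continuous labeling which is clean along all orbits, and whose bits list every bit
of the point infinitely often. -/
theorem exists_initial_labeling (H : IsScaleSystem N s r F) [∀ m, Finite (F m)]
    [∀ m, TopologicalSpace (F m)] [∀ m, DiscreteTopology (F m)] (hζ : IsFreeAction ζ) :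
    ∃ S : Cantor → Label F, Continuous S ∧ (∀ x i, (S x).1 i = x i.unpair.1) ∧
      ∀ x m, CleanAt N r q m (orbitLabeling ζ S x) := by
  let K : ℕ → Set Γ := fun m => {γ | N m (r m) 1 γ} \ {1}
  have hKfin : ∀ m, (K m).Finite := fun m => (H.finite m (r m) 1).sdiff
  have hK1 : ∀ m, (1 : Γ) ∉ K m := fun m h => h.2 rfl
  have hKinv : ∀ m, ∀ γ ∈ K m, γ⁻¹ ∈ K m := by
    rintro m γ ⟨hγ, hγ1⟩
    refine ⟨H.symm ?_, by simpa using hγ1⟩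
    have := (H.mul_right γ⁻¹).2 hγ
    simpa using this
  have hKcard : ∀ m, (K m).ncard + 1 < Nat.card (F m) := fun m => by
    rw [Set.ncard_sdiff_singleton_add_one (show (1 : Γ) ∈ {γ | N m (r m) 1 γ} from H.refl _ _ _)
      (H.finite m (r m) 1)]
    exact H.card_labels m 1
  have hKmem : ∀ {m γ γ'}, γ ≠ γ' → N m (r m) γ γ' → γ' * γ⁻¹ ∈ K m := fun hne h =>
    ⟨H.near_mul_inv.2 h, fun h1 => hne (mul_inv_eq_one.1 h1).symm⟩
  choose next hnextA hnextc hnextsp hnextmax using fun (m : ℕ) (A : {A : Set Cantor // IsClopen A}) =>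
    exists_clopen_maximal hζ (hKfin m) (hK1 m) (hKinv m) A.2
  let T : ℕ → {A : Set Cantor // IsClopen A} := fun m => Nat.rec
    ⟨next 0 ⟨Set.univ, isClopen_univ⟩, hnextc _ _⟩ (fun m A => ⟨next (m + 1) A, hnextc _ _⟩) m
  let P : ℕ → {A : Set Cantor // IsClopen A} := fun m => Nat.casesOn m ⟨Set.univ, isClopen_univ⟩ T
  have hTP : ∀ m, (T m).1 = next m (P m) := fun m => by cases m <;> rfl
  choose g hgcont hgT hgp using fun m => exists_continuous_coloring hζ (hKfin m) (hK1 m) (hKinv m)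
    (T m).2 (by rw [hTP]; exact hnextsp m (P m)) (hKcard m) (q m)
  let S : Cantor → Label F := fun x => (fun i => x i.unpair.1, fun m => g m x)
  have hmark : ∀ x m γ, γ ∈ marked q m (orbitLabeling ζ S x) ↔ ζ γ x ∈ (T m).1 := fun x m γ =>
    hgT m _
  have hpre : ∀ x m γ, γ ∈ premarked q m (orbitLabeling ζ S x) ↔ ζ γ x ∈ (P m).1 := by
    intro x m γ
    cases m with
    | zero => exact Iff.rfl
    | succ m => exact hmark x m γ
  refine ⟨S, ?_, fun _ _ => rfl, fun x m => ⟨fun γ γ' hne hn => ?_, fun γ hγ => ?_, fun γ hγ => ?_⟩⟩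
  · exact (continuous_pi fun i => continuous_apply _).prodMk (continuous_pi fun m => hgcont m)
  · have := hgp m (ζ γ x) _ (hKmem hne hn)
    rw [← apply_mul, inv_mul_cancel_right] at this
    exact this
  · rw [hmark, hTP] at hγ
    exact (hpre x m γ).2 (hnextA m (P m) hγ)
  · rcases hnextmax m (P m) _ ((hpre x m γ).1 hγ) with h | ⟨δ, hδ, h⟩
    · exact ⟨γ, (hmark x m γ).2 (by rwa [hTP]), H.refl _ _ _⟩
    · refine ⟨δ * γ, (hmark x m _).2 (by rwa [hTP, apply_mul]), H.near_mul.1 hδ.1⟩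

/-- The labelings obtained by repairing a labeling at more and more levels. -/
noncomputable def labelingSeq (ζ : Γ →* (Cantor ≃ₜ Cantor)) (N : ℕ → ℕ → Γ → Γ → Prop)
    (s r : ℕ → ℕ) (q : ∀ m, F m) (S₀ : Cantor → Label F) : ℕ → Cantor → Label F
  | 0 => S₀
  | i + 1 => fun x => repairAt N s r q i (orbitLabeling ζ (labelingSeq ζ N s r q S₀ i) x)

theorem orbitLabeling_labelingSeq_succ (S₀ : Cantor → Label F) (i : ℕ) (x : Cantor) :
    orbitLabeling ζ (labelingSeq ζ N s r q S₀ (i + 1)) x =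
      repair N s r q i (orbitLabeling ζ (labelingSeq ζ N s r q S₀ i) x) := by
  funext γ
  rw [repair, shift_orbitLabeling]
  rfl

theorem labelingSeq_good (H : IsScaleSystem N s r F) [∀ m, Finite (F m)] {S₀ : Cantor → Label F}
    (hS₀ : ∀ x m, CleanAt N r q m (orbitLabeling ζ S₀ x)) (i : ℕ) (x : Cantor) :
    Good N s r q (i + 1) (orbitLabeling ζ (labelingSeq ζ N s r q S₀ i) x) ∧
      ∀ m, CleanAt N r q m (orbitLabeling ζ (labelingSeq ζ N s r q S₀ i) x) := by
  induction i with
  | zero => exact ⟨hS₀ x 0, hS₀ x⟩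
  | succ i ih =>
    rw [orbitLabeling_labelingSeq_succ]
    have hg := good_repair H (gluable H i) ih.1 (ih.2 (i + 1))
    refine ⟨hg, fun m => ?_⟩
    rcases le_or_gt m (i + 1) with hm | hm
    · exact (hg.mono (Nat.succ_le_succ hm)).cleanAt
    · obtain ⟨m, rfl⟩ : ∃ k, m = k + 1 := ⟨m - 1, by omega⟩
      refine cleanAt_congr (fun y => (repair_high i _ y (by omega)).2) (Set.ext fun y => ?_)
        (ih.2 (m + 1))
      show (repair N s r q i _ y).2 m = q m ↔ _
      rw [(repair_high i _ y (by omega)).2]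
      rfl

theorem labelingSeq_bit (S₀ : Cantor → Label F) {n i : ℕ} (hi : n ≤ i) (x : Cantor) :
    (labelingSeq ζ N s r q S₀ n x).1 i = (S₀ x).1 i := by
  induction n with
  | zero => rfl
  | succ n ih =>
    rw [← ih (by omega)]
    refine (repairAt_high n _ (by omega)).1.trans ?_
    simp [orbitLabeling]

theorem labelingSeq_ne (H : IsScaleSystem N s r F) [∀ m, Finite (F m)] {S₀ : Cantor → Label F}
    (hS₀ : ∀ x m, CleanAt N r q m (orbitLabeling ζ S₀ x)) {i : ℕ} {x : Cantor}
    (hx : labelingSeq ζ N s r q S₀ (i + 1) x ≠ labelingSeq ζ N s r q S₀ i x) :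
    ∃ δ, N i (5 * s i) 1 δ ∧ (labelingSeq ζ N s r q S₀ i (ζ δ x)).2 i = q i := by
  obtain ⟨hg, hc⟩ := labelingSeq_good H hS₀ i x
  have hne : repair N s r q i (orbitLabeling ζ (labelingSeq ζ N s r q S₀ i) x) 1 ≠
      orbitLabeling ζ (labelingSeq ζ N s r q S₀ i) x 1 := by
    rw [← orbitLabeling_labelingSeq_succ]
    simpa [orbitLabeling] using hx
  obtain ⟨-, δ, hδ, hδ1⟩ := of_repair_ne H (gluable H i) hg (hc (i + 1)) hne
  exact ⟨δ, H.symm hδ1, hδ⟩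

variable [∀ m, TopologicalSpace (F m)] [∀ m, DiscreteTopology (F m)]

theorem eventually_agree (k : ℕ) (l : Label F) : ∀ᶠ l' in 𝓝 l, Agree k l' l := by
  have h : ∀ i ∈ Set.Iio k, ∀ᶠ l' : Label F in 𝓝 l, l'.1 i = l.1 i ∧ l'.2 i = l.2 i := by
    intro i _
    have h1 : Continuous fun l' : Label F => l'.1 i := (continuous_apply i).comp continuous_fst
    have h2 : Continuous fun l' : Label F => l'.2 i := (continuous_apply i).comp continuous_snd
    have d1 : ∀ᶠ b in 𝓝 (l.1 i), b = l.1 i := by simp [nhds_discrete]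
    have d2 : ∀ᶠ b in 𝓝 (l.2 i), b = l.2 i := by simp [nhds_discrete]
    exact ((h1.tendsto l).eventually d1).and ((h2.tendsto l).eventually d2)
  exact (Set.finite_Iio k).eventually_all.2 h

theorem continuous_repairAt (H : IsScaleSystem N s r F) {S : Cantor → Label F} (hS : Continuous S)
    (m : ℕ) : Continuous fun x => repairAt N s r q m (orbitLabeling ζ S x) := by
  have hloc : ∀ x, ∀ᶠ y in 𝓝 x, Agree m (repairAt N s r q m (orbitLabeling ζ S y))
      (repairAt N s r q m (orbitLabeling ζ S x)) := by
    intro x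
    have : ∀ γ ∈ {γ | N (m + 1) (r (m + 1)) 1 γ},
        ∀ᶠ y in 𝓝 x, Agree (m + 2) (S (ζ γ y)) (S (ζ γ x)) := fun γ _ =>
      (hS.comp (ζ γ).continuous).continuousAt.eventually (eventually_agree _ _)
    filter_upwards [(H.finite (m + 1) (r (m + 1)) 1).eventually_all.2 this] with y hy
    exact repairAt_agree H hy
  have hS1 : (fun x => orbitLabeling ζ S x 1) = S := funext fun x => by
    simp [orbitLabeling]
  refine Continuous.prodMk (f := fun x => (repairAt N s r q m (orbitLabeling ζ S x)).1)
    (g := fun x => (repairAt N s r q m (orbitLabeling ζ S x)).2)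
    (continuous_pi fun i => ?_) (continuous_pi fun i => ?_)
  · by_cases hi : i < m
    · refine continuous_iff_continuousAt.2 fun x => ?_
      exact tendsto_const_nhds.congr' ((hloc x).mono fun y hy => (hy i hi).1.symm)
    · simp only [fun x => (repairAt_high (N := N) (s := s) (r := r) (q := q) m
        (orbitLabeling ζ S x) (not_lt.1 hi)).1]
      simp only [orbitLabeling, apply_one]
      exact (continuous_apply i).comp (continuous_fst.comp hS)
  · by_cases hi : i < m
    · refine continuous_iff_continuousAt.2 fun x => ?_
      exact tendsto_const_nhds.congr' ((hloc x).mono fun y hy => (hy i hi).2.symm)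
    · simp only [fun x => (repairAt_high (N := N) (s := s) (r := r) (q := q) m
        (orbitLabeling ζ S x) (not_lt.1 hi)).2]
      simp only [orbitLabeling, apply_one]
      exact (continuous_apply i).comp (continuous_snd.comp hS)

theorem continuous_labelingSeq (H : IsScaleSystem N s r F) {S₀ : Cantor → Label F}
    (hS₀ : Continuous S₀) (i : ℕ) : Continuous (labelingSeq ζ N s r q S₀ i) := by
  induction i with
  | zero => exact hS₀
  | succ i ih => exact continuous_repairAt H ih i

end Orbit

section Conclusion

variable {Γ : Type*} [Group Γ] {F : ℕ → Type*} {ζ : Γ →* (Cantor ≃ₜ Cantor)}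
  {N : ℕ → ℕ → Γ → Γ → Prop} {s r : ℕ → ℕ} {q : ∀ m, F m}

/-- The labelings which are good at all levels. -/
def goodLabelings (N : ℕ → ℕ → Γ → Γ → Prop) (s r : ℕ → ℕ) (q : ∀ m, F m) : Set (Γ → Label F) :=
  {ρ | ∀ k, Good N s r q k ρ}

theorem isAlmostClean_of_cleanAt {σ : ℕ → Γ} {f : ℕ → ℕ} {Θ : Γ → Label F}
    (h : ∀ m, CleanAt (near σ f) r q m Θ) : IsAlmostClean σ r f q Θ := by
  have key : ∀ m, IsMaximalSparseIn (cayley σ (f m)) (premarked q m Θ) (r m) (marked q m Θ) := by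
    intro m
    refine ⟨⟨(h m).subset, fun x hx y hy hne => ?_⟩, fun T' hT' _ x hx => ?_⟩
    · by_contra hle
      exact hne ((h m).eq_of_near hx hy (not_lt.1 hle))
    · obtain ⟨y, hy, hxy⟩ := (h m).maximal x (hT'.1 hx)
      by_contra hxm
      have hne : x ≠ y := fun e => hxm (e ▸ hy)
      exact absurd hxy (not_le.2 (hT'.2 x hx y (by tauto) hne))
  exact ⟨key 0, fun m => key (m + 1), fun m x y hne hxy => (h m).proper x y hne hxy⟩

theorem eventually_eq_of_mem_stablePoints {S : ℕ → Cantor → Label F} {y : Cantor}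
    (hy : y ∈ stablePoints ζ S) (γ : Γ) : ∃ l, ∀ᶠ n in atTop, S n (ζ γ y) = l := by
  obtain ⟨n₀, hn₀⟩ := hy γ
  exact ⟨_, eventually_atTop.2 ⟨n₀, hn₀⟩⟩

theorem mem_stablePoints_of_eventually {S : ℕ → Cantor → Label F} {y : Cantor}
    (h : ∀ γ : Γ, ∀ᶠ n in atTop, S (n + 1) (ζ γ y) = S n (ζ γ y)) : y ∈ stablePoints ζ S := by
  intro γ
  obtain ⟨n₀, hn₀⟩ := eventually_atTop.1 (h γ)
  refine ⟨n₀, fun n hn => ?_⟩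
  induction n, hn using Nat.le_induction with
  | base => rfl
  | succ n hn ih => rw [hn₀ n hn, ih]

theorem apply_mem_stablePoints {S : ℕ → Cantor → Label F} {y : Cantor}
    (hy : y ∈ stablePoints ζ S) (δ : Γ) : ζ δ y ∈ stablePoints ζ S := by
  intro γ
  rw [← apply_mul]
  exact hy (γ * δ)

theorem good_of_frequently (H : IsScaleSystem N s r F) {ι : Type*} {l : Filter ι}
    {u : ι → Γ → Label F} {ρ : Γ → Label F} {k : ℕ} (hu : ∀ᶠ i in l, Good N s r q k (u i))
    (h : ∀ W : Set Γ, W.Finite → ∃ᶠ i in l, ∀ x ∈ W, Agree k (ρ x) (u i x)) :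
    Good N s r q k ρ := by
  cases k with
  | zero => trivial
  | succ k =>
    refine good_of_local H fun p => ?_
    obtain ⟨i, hi, hg⟩ := ((h {x | N k (r k) p x} (H.finite _ _ _)).and_eventually hu).exists
    exact ⟨u i, hg, hi⟩

section Topological

variable [∀ m, TopologicalSpace (F m)]

theorem tendsto_label {ι : Type*} {l : Filter ι} {u : ι → Label F} {a : Label F}
    (h : ∀ k, ∀ᶠ i in l, Agree k (u i) a) : Tendsto u l (𝓝 a) := by
  refine Prod.tendsto_iff u a |>.2 ⟨tendsto_pi_nhds.2 fun i => ?_, tendsto_pi_nhds.2 fun i => ?_⟩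
  · exact tendsto_const_nhds.congr' ((h (i + 1)).mono fun n hn => (hn i i.lt_succ_self).1.symm)
  · exact tendsto_const_nhds.congr' ((h (i + 1)).mono fun n hn => (hn i i.lt_succ_self).2.symm)

/-- Every pattern of a good labeling occurs in every other one. -/
theorem mem_closure_orbit (H : IsScaleSystem N s r F) {ρ ρ' : Γ → Label F}
    (hρ : ρ ∈ goodLabelings N s r q) (hρ' : ρ' ∈ goodLabelings N s r q) :
    ρ' ∈ closure (Set.range fun δ : Γ => shift δ ρ) := by
  have hvisit : ∀ m, ∃ ε, ∀ γ, N m (s m / 2) 1 γ → Agree m (ρ (γ * ε)) (ρ' γ) := by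
    intro m
    obtain ⟨c, hc, -⟩ := exists_marked_near H (hρ (m + 2)) 1
    obtain ⟨ε, -, hε⟩ := (hρ (m + 2)).visitsAll hc ρ' (hρ' m)
    exact ⟨ε, hε⟩
  choose ε hε using hvisit
  refine mem_closure_of_tendsto (f := fun m => shift (ε m) ρ) (b := atTop) ?_
    (Eventually.of_forall fun m => ⟨ε m, rfl⟩)
  refine tendsto_pi_nhds.2 fun γ => tendsto_label fun k => ?_
  obtain ⟨m₀, hm₀⟩ := H.exhaust γ
  filter_upwards [eventually_ge_atTop m₀, eventually_ge_atTop k] with m hm hk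
  exact (hε m γ (hm₀ m hm)).mono hk

variable [∀ m, DiscreteTopology (F m)]

theorem measurableSet_stablePoints [Countable Γ] {S : ℕ → Cantor → Label F}
    (hS : ∀ n, Continuous (S n)) : MeasurableSet (stablePoints ζ S) := by
  have : stablePoints ζ S = ⋂ γ : Γ, ⋃ n₀ : ℕ, ⋂ n : ℕ, ⋂ _ : n₀ ≤ n,
      {y | S n (ζ γ y) = S n₀ (ζ γ y)} := by
    ext y
    simp [stablePoints]
  rw [this]
  refine MeasurableSet.iInter fun γ => MeasurableSet.iUnion fun n₀ => MeasurableSet.iInter fun n =>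
    MeasurableSet.iInter fun _ => (isClosed_eq ?_ ?_).measurableSet
  · exact (hS n).comp (ζ γ).continuous
  · exact (hS n₀).comp (ζ γ).continuous

/-- Labels of level `i` which are distinguished are rare, and therefore so are the points at which
the labelings change. -/
theorem measure_ne_le [Countable Γ] (H : IsScaleSystem N s r F) [∀ m, Finite (F m)]
    {S₀ : Cantor → Label F} (hS₀c : Continuous S₀)
    (hS₀ : ∀ x m, CleanAt N r q m (orbitLabeling ζ S₀ x)) (μ : Measure Cantor)
    [IsProbabilityMeasure μ] (hμ : ∀ γ, μ.map (ζ γ) = μ) (i : ℕ) :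
    μ {x | labelingSeq ζ N s r q S₀ (i + 1) x ≠ labelingSeq ζ N s r q S₀ i x} ≤
      (10⁻¹ : ENNReal) ^ (i + 1) := by
  set S := labelingSeq ζ N s r q S₀ i with hS
  let T : Set Cantor := {x | (S x).2 i = q i}
  have hTm : MeasurableSet T := (isClosed_eq ((continuous_apply i).comp
    (continuous_snd.comp (continuous_labelingSeq H hS₀c i))) continuous_const).measurableSet
  have hpre : ∀ γ, μ (ζ γ ⁻¹' T) = μ T := fun γ => by
    conv_rhs => rw [← hμ γ]
    exact (Measure.map_apply (ζ γ).continuous.measurable hTm).symm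
  let B : ℕ → Finset Γ := fun t => (H.finite i t 1).toFinset
  have hB : ∀ t, (B t).card = {y | N i t 1 y}.ncard := fun t =>
    (Set.ncard_eq_toFinset_card _ _).symm
  have h1 : μ {x | labelingSeq ζ N s r q S₀ (i + 1) x ≠ S x} ≤ (B (5 * s i)).card * μ T := by
    calc _ ≤ μ (⋃ γ ∈ B (5 * s i), ζ γ ⁻¹' T) := by
          refine measure_mono fun x hx => ?_
          obtain ⟨δ, hδ, hδx⟩ := labelingSeq_ne H hS₀ hx
          exact Set.mem_biUnion (show δ ∈ B (5 * s i) by simpa [B] using hδ) hδx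
      _ ≤ ∑ γ ∈ B (5 * s i), μ (ζ γ ⁻¹' T) := measure_biUnion_finset_le _ _
      _ = _ := by simp [hpre]
  have h2 : (B (r i / 10)).card * μ T ≤ 1 := by
    calc _ = ∑ γ ∈ B (r i / 10), μ (ζ γ ⁻¹' T) := by simp [hpre]
      _ = μ (⋃ γ ∈ B (r i / 10), ζ γ ⁻¹' T) := by
          refine (measure_biUnion_finset ?_ fun γ _ => (ζ γ).continuous.measurable hTm).symm
          intro γ hγ δ hδ hne
          refine Set.disjoint_left.2 fun x hx hx' => hne ?_
          refine ((labelingSeq_good H hS₀ i x).2 i).eq_of_near hx hx' ?_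
          have hγ' : N i (r i / 10) 1 γ := by simpa [B] using hγ
          have hδ' : N i (r i / 10) 1 δ := by simpa [B] using hδ
          exact H.mono le_rfl (by omega) (H.trans (H.symm hγ') hδ')
      _ ≤ 1 := prob_le_one
  have h3 : 10 ^ (i + 1) * (B (5 * s i)).card ≤ (B (r i / 10)).card := by
    rw [hB, hB]
    exact H.card_ball i
  have h4 : (10 : ENNReal) ^ (i + 1) * ((B (5 * s i)).card * μ T) ≤ 1 := by
    refine le_trans ?_ h2
    rw [← mul_assoc]
    gcongr
    exact_mod_cast h3
  rw [ENNReal.inv_pow.symm, ENNReal.le_inv_iff_mul_le, mul_comm]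
  exact (mul_le_mul_right h1 _).trans h4

theorem measure_stablePoints [Countable Γ] (H : IsScaleSystem N s r F) [∀ m, Finite (F m)]
    {S₀ : Cantor → Label F} (hS₀c : Continuous S₀)
    (hS₀ : ∀ x m, CleanAt N r q m (orbitLabeling ζ S₀ x)) (μ : Measure Cantor)
    [IsProbabilityMeasure μ] (hμ : ∀ γ, μ.map (ζ γ) = μ) :
    μ (stablePoints ζ (labelingSeq ζ N s r q S₀)) = 1 := by
  have hcont := fun i => continuous_labelingSeq (ζ := ζ) (q := q) H hS₀c i
  have hae : ∀ γ, ∀ᵐ x ∂μ, ∀ᶠ n in atTop,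
      labelingSeq ζ N s r q S₀ (n + 1) (ζ γ x) = labelingSeq ζ N s r q S₀ n (ζ γ x) := by
    intro γ
    have hsum : ∑' i, μ (ζ γ ⁻¹' {x | labelingSeq ζ N s r q S₀ (i + 1) x ≠
        labelingSeq ζ N s r q S₀ i x}) ≠ ⊤ := by
      refine ne_top_of_le_ne_top ?_ (ENNReal.tsum_le_tsum (g := fun i => (10⁻¹ : ENNReal) ^ (i + 1))
        fun i => ?_)
      · rw [ENNReal.tsum_geometric_add_one]
        refine ENNReal.mul_ne_top (by simp) (ENNReal.inv_ne_top.2 ?_)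
        refine (tsub_pos_of_lt ?_).ne'
        simp
      · have hm : MeasurableSet {x | labelingSeq ζ N s r q S₀ (i + 1) x ≠
            labelingSeq ζ N s r q S₀ i x} :=
          (isOpen_ne_fun (hcont (i + 1)) (hcont i)).measurableSet
        rw [← Measure.map_apply (ζ γ).continuous.measurable hm, hμ γ]
        exact measure_ne_le H hS₀c hS₀ μ hμ i
    filter_upwards [ae_eventually_notMem hsum] with x hx
    filter_upwards [hx] with n hn
    simpa using hn
  refine (mem_ae_iff_prob_eq_one (measurableSet_stablePoints hcont)).1 ?_
  filter_upwards [ae_all_iff.2 hae] with x hx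
  exact mem_stablePoints_of_eventually hx

theorem eventually_agree_on {Γ : Type*} (ρ : Γ → Label F) (k : ℕ) {W : Set Γ} (hW : W.Finite) :
    ∀ᶠ ρ' in 𝓝 ρ, ∀ x ∈ W, Agree k (ρ x) (ρ' x) := by
  refine hW.eventually_all.2 fun x _ => ?_
  exact ((continuous_apply x).continuousAt.eventually (eventually_agree k (ρ x))).mono
    fun _ h => h.symm

theorem isClosed_goodLabelings (H : IsScaleSystem N s r F) :
    IsClosed (goodLabelings N s r q) := by
  refine isClosed_of_closure_subset fun ρ hρ k => ?_
  rw [mem_closure_iff_frequently] at hρ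
  refine good_of_frequently H (l := 𝓝 ρ ⊓ 𝓟 (goodLabelings N s r q)) (u := id)
    (eventually_inf_principal.2 (Eventually.of_forall fun ρ' h => h k)) fun W hW => ?_
  rw [frequently_inf_principal]
  exact (hρ.and_eventually (eventually_agree_on ρ k hW)).mono fun _ h => h

theorem goodLabelings_nonempty (H : IsScaleSystem N s r F) [∀ m, Finite (F m)]
    {u : ℕ → Γ → Label F} (hu : ∀ n, Good N s r q (n + 1) (u n)) :
    (goodLabelings N s r q).Nonempty := by
  obtain ⟨ρ, hρ⟩ := exists_clusterPt_of_compactSpace (map u atTop)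
  refine ⟨ρ, fun k => good_of_frequently H (l := atTop) (u := u) ?_ fun W hW => ?_⟩
  · filter_upwards [eventually_ge_atTop k] with n hn
    exact (hu n).mono (hn.trans (Nat.le_succ n))
  · exact MapClusterPt.frequently hρ (eventually_agree_on ρ k hW)

theorem isFreeMinimalSubshift_goodLabelings (H : IsScaleSystem N s r F)
    (hne : (goodLabelings N s r q).Nonempty) : IsFreeMinimalSubshift (goodLabelings N s r q) where
  isClosed := isClosed_goodLabelings H
  nonempty := hne
  shift_mem δ ρ hρ k := good_shift H δ (hρ k)
  minimal ρ hρ ρ' hρ' := mem_closure_orbit H hρ hρ'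
  free δ ρ hρ hfix := by
    by_contra hδ
    obtain ⟨m, hm⟩ := H.exhaust δ
    have hs := H.s_lt_r m
    refine (hρ (m + 1)).cleanAt.proper 1 δ (Ne.symm hδ)
      (H.mono le_rfl (by omega) (hm m le_rfl)) ?_
    have := congrFun hfix 1
    simp only [shift, one_mul] at this
    rw [this]

theorem measurable_of_eventually_eq [∀ m, MeasurableSpace (F m)] [∀ m, BorelSpace (F m)]
    {α : Type*} [MeasurableSpace α] {u : ℕ → α → Label F} {v : α → Label F}
    (hu : ∀ n i, Measurable fun x => (u n x).1 i) (hu' : ∀ n i, Measurable fun x => (u n x).2 i)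
    (h : ∀ x, ∀ᶠ n in atTop, u n x = v x) : Measurable v := by
  refine Measurable.prodMk (f := fun x => (v x).1) (g := fun x => (v x).2)
    (measurable_pi_iff.2 fun i => ?_) (measurable_pi_iff.2 fun i => ?_)
  · refine measurable_of_tendsto_metrizable (fun n => hu n i) (tendsto_pi_nhds.2 fun x => ?_)
    exact tendsto_const_nhds.congr' ((h x).mono fun n hn => by simp only [hn])
  · refine measurable_of_tendsto_metrizable (fun n => hu' n i) (tendsto_pi_nhds.2 fun x => ?_)
    exact tendsto_const_nhds.congr' ((h x).mono fun n hn => by simp only [hn])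

end Topological

end Conclusion

end CantorLabeling

open CantorLabeling
theorem mainTheorem8 {Γ : Type*} [Group Γ] [Countable Γ] [Infinite Γ]
    (σ : ℕ → Γ) (hσ : IsGeneratingSystem σ)
    (s r f : ℕ → ℕ) (F : ℕ → Type*) [∀ m, Finite (F m)]
    [∀ m, TopologicalSpace (F m)] [∀ m, DiscreteTopology (F m)]
    [∀ m, MeasurableSpace (F m)] [∀ m, BorelSpace (F m)]
    (q : ∀ m, F m) (hrules : IsAdmissible σ s r f F)
    (ζ : Γ →* (Cantor ≃ₜ Cantor)) (hζ : IsFreeAction ζ) :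
    ∃ S : ℕ → Cantor → Label F,
      (∀ i, IsDynamicalClean ζ σ r f q (S i)) ∧
      MeasurableSet (stablePoints ζ S) ∧
      (∀ γ, ∀ y ∈ stablePoints ζ S, ζ γ y ∈ stablePoints ζ S) ∧
      (∀ μ : Measure Cantor, IsProbabilityMeasure μ → (∀ γ, μ.map (ζ γ) = μ) →
        μ (stablePoints ζ S) = 1) ∧
      ∃ M : Set (Γ → Label F), IsFreeMinimalSubshift M ∧
        ∃ Φ : stablePoints ζ S → Γ → Label F,
          (∀ (y : stablePoints ζ S) (γ : Γ), ∀ᶠ n in atTop, S n (ζ γ y) = Φ y γ) ∧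
          (∀ y, Φ y ∈ M) ∧
          Measurable Φ ∧
          Function.Injective Φ ∧
          ∀ (δ : Γ) (y y' : stablePoints ζ S), (y' : Cantor) = ζ δ y →
            Φ y' = shift δ (Φ y) := by
  have H := isScaleSystem_near hrules hσ
  obtain ⟨S₀, hS₀c, hS₀bit, hS₀⟩ := exists_initial_labeling (q := q) H hζ
  set S := labelingSeq ζ (near σ f) s r q S₀ with hS
  have hcont : ∀ i, Continuous (S i) := fun i => continuous_labelingSeq H hS₀c i
  have hgood := fun i x => labelingSeq_good H hS₀ i x
  choose Φ hΦ using fun y : stablePoints ζ S => eventually_eq_of_mem_stablePoints y.2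
  refine ⟨S, fun i => ⟨hcont i, fun x => isAlmostClean_of_cleanAt (hgood i x).2⟩,
    measurableSet_stablePoints hcont, fun γ y hy => apply_mem_stablePoints hy γ,
    fun μ _ hμ => measure_stablePoints H hS₀c hS₀ μ hμ,
    goodLabelings (near σ f) s r q, isFreeMinimalSubshift_goodLabelings H
      (goodLabelings_nonempty H fun n => (hgood n fun _ => false).1), Φ, hΦ, fun y k => ?_, ?_,
    fun y y' hyy' => ?_, fun δ y y' hy' => ?_⟩
  · refine good_of_frequently H (l := atTop) (u := fun n => orbitLabeling ζ (S n) y) ?_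
      fun W hW => (hW.eventually_all.2 fun x _ => ?_).frequently
    · filter_upwards [eventually_ge_atTop k] with n hn
      exact (hgood n y).1.mono (hn.trans (Nat.le_succ n))
    · exact (hΦ y x).mono fun n hn => Agree.of_eq hn.symm
  · refine measurable_pi_iff.2 fun γ => measurable_of_eventually_eq
      (u := fun n (y : stablePoints ζ S) => S n (ζ γ y)) (fun n i => ?_) (fun n i => ?_)
      fun y => hΦ y γ
    · exact ((continuous_apply i).comp (continuous_fst.comp ((hcont n).comp
        (ζ γ).continuous))).measurable.comp measurable_subtype_coe
    · exact ((continuous_apply i).comp (continuous_snd.comp ((hcont n).comp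
        (ζ γ).continuous))).measurable.comp measurable_subtype_coe
  · have hbit : ∀ y : stablePoints ζ S, ∃ n₀, ∀ i ≥ n₀, (Φ y 1).1 i = (y : Cantor) i.unpair.1 := by
      intro y
      obtain ⟨n₀, hn₀⟩ := (hΦ y 1).exists
      refine ⟨n₀, fun i hi => ?_⟩
      rw [← hn₀, apply_one]
      exact (labelingSeq_bit S₀ hi _).trans (hS₀bit _ _)
    obtain ⟨n₁, h₁⟩ := hbit y
    obtain ⟨n₂, h₂⟩ := hbit y'
    refine Subtype.ext (funext fun j => ?_)
    have hge := Nat.right_le_pair j (max n₁ n₂)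
    have e₁ := h₁ (Nat.pair j (max n₁ n₂)) ((le_max_left _ _).trans hge)
    have e₂ := h₂ (Nat.pair j (max n₁ n₂)) ((le_max_right _ _).trans hge)
    rw [Nat.unpair_pair] at e₁ e₂
    rw [← e₁, ← e₂, hyy']
  · funext γ
    obtain ⟨n, h₁, h₂⟩ := ((hΦ y' γ).and (hΦ y (γ * δ))).exists
    rw [shift, ← h₁, ← h₂, hy', apply_mul]
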